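/- **Setting.** Let $X\in\mathbb R^{n\times d}$ be a nonzero design matrix, let $\hat\Sigma=\frac1n X^\top X$, and let $\lambda$ and $\Lambda$ be the smallest nonzero and the largest eigenvalue of $\hat\Sigma$. *Univariate regression.* Given a target $y\in\mathbb R^n$ and a fixed vector $p\in\mathbb R^d$, consider the linear network $x\mapsto p^\top W_L\cdots W_1x$ with weights $\mathcal W=(W_1,\dots,W_L)$, $W_k\in\mathbb R^{d\times d}$. Its empirical risk is $$R(\mathcal W)=\tfrac1n\|y-XW_1^\top\cdots W_L^\top p\|_2^2,\qquad\text{and we let}\qquad R_{\min}=\min_{w\in\mathbb R^d}\tfrac1n\|y-Xw\|_2^2 .$$ *Multivariate regression.* Given a target $Y\in\mathbb R^{n\times d}$, consider the linear network $x\mapsto W_L\cdots W_1x$, with empirical risk $$R(\mathcal W)=\tfrac1n\|Y-XW_1^\top\cdots W_L^\top\|_F^2,\qquad\text{and let}\qquad R_{\min}=\min_{M\in\mathbb R^{d\times d}}\tfrac1n\|Y-XM^\top\|_F^2 .$$ In both cases the network is trained by gradient flow $\frac{dW_k}{dt}=-\frac{\partial R}{\partial W_k}$, $t\ge0$, $1\le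 k\le L$, from the residual initialization $$W_k(0)=I+\frac{s}{\sqrt{Ld}}N_k,$$ where $s\ge 0$ and all the entries of the matrices $N_1,\dots,N_L\in\mathbb R^{d\times d}$ are i.i.d. $\mathcal N(0,1)$. **Theorem.** For every $s\ge0$ there exist constants $C_1,\dots,C_5>0$ depending only on $s$ such that the following holds for all $L\ge C_1$, all $d\ge C_2$ and all $n$. 1. (Univariate.) For all $X\neq0$, $y$ and $p$, with probability at least $1-16\exp(-C_3d)$: if $$R(\mathcal W(0))-R_{\min}\le\frac{C_4\lambda^2\|p\|_2^2}{\Lambda},$$ then the gradient flow is defined for all $t\ge 0$ and converges as $t\to\infty$ to a global minimizer $\mathcal W^{\mathrm{RI}}$ of $R$, which satisfies $$W_k^{\mathrm{RI}}=I+\frac{s}{\sqrt{Ld}}N_k+\frac1L\theta_k^{\mathrm{RI}}\quad\text{with}\quad\|\theta_k^{\mathrm{RI}}\|_F\le C_5,\qquad 1\le k\le L.$$ 2. (Multivariate.) For all $X\ne0$ and $Y$, the same conclusion holds for the multivariate risk, with the condition on the initial risk replaced by $$R(\mathcal W(0))-R_{\min}\le\frac{C_4\lambda^2}{\Lambda}.$$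 -/

import Mathlib

open MeasureTheory ProbabilityTheory Filter Topology Matrix

namespace DeepLinear

noncomputable section

/-- Weights of a depth-`L` linear network of constant width `d`; the matrix usually called
`W_k` (with `1 ≤ k ≤ L`) is `W ⟨k - 1, _⟩`. -/
abbrev Params (L d : ℕ) : Type := Fin L → Matrix (Fin d) (Fin d) ℝ

/-- The product `W_L ⋯ W_2 W_1` (the last layer is the leftmost factor). -/
def netMatrix {L d : ℕ} (W : Params L d) : Matrix (Fin d) (Fin d) ℝ :=
  (List.ofFn W).reverse.prod

/-- The Frobenius norm of a matrix. -/
def frobNorm {m n : ℕ} (M : Matrix (Fin m) (Fin n) ℝ) : ℝ :=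
  Real.sqrt (∑ i, ∑ j, M i j ^ 2)

/-- The empirical covariance matrix `(1/n) Xᵀ X`. -/
def covMatrix {n d : ℕ} (X : Matrix (Fin n) (Fin d) ℝ) : Matrix (Fin d) (Fin d) ℝ :=
  (1 / (n : ℝ)) • (Xᵀ * X)

/-- The smallest nonzero eigenvalue of the empirical covariance matrix
(the set is finite, and nonempty as soon as `X ≠ 0`). -/
def smallestNonzeroEig {n d : ℕ} (X : Matrix (Fin n) (Fin d) ℝ) : ℝ :=
  sInf {μ : ℝ | μ ∈ spectrum ℝ (covMatrix X) ∧ μ ≠ 0}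

/-- The largest eigenvalue of the empirical covariance matrix. -/
def largestEig {n d : ℕ} (X : Matrix (Fin n) (Fin d) ℝ) : ℝ :=
  sSup (spectrum ℝ (covMatrix X))

/-- Risk of the linear regressor `x ↦ wᵀ x`: `(1/n) ‖y - X w‖₂²`. -/
def linRisk {n d : ℕ} (X : Matrix (Fin n) (Fin d) ℝ) (y : Fin n → ℝ) (w : Fin d → ℝ) : ℝ :=
  (1 / (n : ℝ)) * ‖WithLp.toLp 2 (y - X *ᵥ w)‖ ^ 2

/-- Risk of the network `x ↦ pᵀ W_L ⋯ W_1 x`: `(1/n) ‖y - X W_1ᵀ ⋯ W_Lᵀ p‖₂²`. -/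
def netRisk {n d L : ℕ} (X : Matrix (Fin n) (Fin d) ℝ) (y : Fin n → ℝ) (p : Fin d → ℝ)
    (W : Params L d) : ℝ :=
  linRisk X y ((netMatrix W)ᵀ *ᵥ p)

/-- The minimum of the regression risk over all linear regressors. -/
def minRisk {n d : ℕ} (X : Matrix (Fin n) (Fin d) ℝ) (y : Fin n → ℝ) : ℝ :=
  ⨅ w : Fin d → ℝ, linRisk X y w

/-- Multivariate risk of the linear map `x ↦ M x`: `(1/n) ‖Y - X Mᵀ‖_F²`. -/
def linRiskMulti {n d : ℕ} (X Y : Matrix (Fin n) (Fin d) ℝ)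
    (M : Matrix (Fin d) (Fin d) ℝ) : ℝ :=
  (1 / (n : ℝ)) * frobNorm (Y - X * Mᵀ) ^ 2

/-- Multivariate risk of the network `x ↦ W_L ⋯ W_1 x`. -/
def netRiskMulti {n d L : ℕ} (X Y : Matrix (Fin n) (Fin d) ℝ) (W : Params L d) : ℝ :=
  linRiskMulti X Y (netMatrix W)

/-- The minimum of the multivariate risk over all linear maps. -/
def minRiskMulti {n d : ℕ} (X Y : Matrix (Fin n) (Fin d) ℝ) : ℝ :=
  ⨅ M : Matrix (Fin d) (Fin d) ℝ, linRiskMulti X Y M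

/-- The partial gradient `∂R/∂W_k` at `W`: the matrix of the partial derivatives of `R` with
respect to the entries of the `k`-th weight matrix. -/
def layerGrad {L d : ℕ} (R : Params L d → ℝ) (W : Params L d) (k : Fin L) :
    Matrix (Fin d) (Fin d) ℝ :=
  Matrix.of fun i j => lineDeriv ℝ R W (Pi.single k (Matrix.single i j (1 : ℝ)))

/-- `W` solves the gradient flow `dW_k/dt = - ∂R/∂W_k` on `[0, ∞)` with initial value `W₀`
(the derivative at `t = 0` is the one-sided one). -/
def IsGradientFlow {L d : ℕ} (R : Params L d → ℝ) (W₀ : Params L d) (W : ℝ → Params L d) :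
    Prop :=
  W 0 = W₀ ∧ ∀ t : ℝ, 0 ≤ t → ∀ k i j,
    HasDerivWithinAt (fun τ => W τ k i j) (-(layerGrad R (W t) k i j)) (Set.Ici 0) t

/-- The gradient flow of `R` started at `W₀` exists for all nonnegative times and converges
to `W'` as time goes to infinity. -/
def GradientFlowConvergesTo {L d : ℕ} (R : Params L d → ℝ) (W₀ W' : Params L d) : Prop :=
  (∃ W : ℝ → Params L d, IsGradientFlow R W₀ W) ∧
    ∀ W : ℝ → Params L d, IsGradientFlow R W₀ W → Tendsto W atTop (𝓝 W')

/-- `W'` is a global minimizer of `R`. -/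
def IsGlobalMinimizer {L d : ℕ} (R : Params L d → ℝ) (W' : Params L d) : Prop :=
  ∀ V : Params L d, R W' ≤ R V

/-- The `N_k` are random matrices whose entries, over all `k`, are i.i.d. standard Gaussian. -/
def IsGaussianNoise {Ω : Type*} [MeasurableSpace Ω] (P : Measure Ω) {L d : ℕ}
    (N : Ω → Params L d) : Prop :=
  (∀ k i j, HasLaw (fun ω => N ω k i j) (gaussianReal 0 1) P) ∧
    iIndepFun (fun (q : Fin L × Fin d × Fin d) ω => N ω q.1 q.2.1 q.2.2) P

/-- Residual weights `W_k = I + s / √(L d) N_k + θ_k / L`. -/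
def residualWeights {L d : ℕ} (s : ℝ) (N θ : Params L d) : Params L d :=
  fun k => 1 + (s / Real.sqrt ((L : ℝ) * d)) • N k + (1 / (L : ℝ)) • θ k

/-- Residual initialization `W_k(0) = I + s / √(L d) N_k`. -/
def residualInit {L d : ℕ} (s : ℝ) (N : Params L d) : Params L d :=
  fun k => 1 + (s / Real.sqrt ((L : ℝ) * d)) • N k

end

end DeepLinear

namespace DeepLinear

/-! The risk is a convex quadratic `ρ` of the end-to-end matrix. Writing `m` for its minimum and `G`
for its gradient, diagonalizing the covariance matrix gives 4α(ρ - m) ≤ ‖G‖² ≤ 4β(ρ - m), where α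
and β are λ and Λ, multiplied by ‖p‖² in the univariate case (`IsComparable`). The gradient in layer
`k` is `G` multiplied on the left by the transposed suffix product and on the right by the
transposed prefix product. If these products and their inverses have bounded norm, every layer
gradient is comparable to `G`. The network risk then satisfies a Polyak-Łojasiewicz inequality with
a constant proportional to `L`.

Suppose the prefix products at initialization have norm and inverse norm at most `A`. A perturbation
of size 1/(2A²L) per layer at most doubles this bound (`prefixProd_twoSided_of_near`). As long as
the flow stays in that neighbourhood, the excess risk decays exponentially and each layer travels at
most a multiple of √(β · initial excess)/(Lα). A small initial excess keeps this below half the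
allowed radius, so the flow never leaves. It is therefore global, Cauchy and convergent, and its
limit has zero excess (`IsComparable.gradientFlow_converges`).

It remains to bound the prefix products at initialization independently of `L` and `d`; this event
involves only the noise. For a fixed unit vector, one layer multiplies the moment of order 2d of the
norm by exp(O(s²d/L)). The same holds for the moment of order -4d once layers nearly annihilating
the current direction are excluded. A maximal inequality (`maximal_prefixProd`) controls all depths
at once with failure probability exponentially small in `d`, and a net of exp(O(d)) points passes
from fixed vectors to the whole sphere (`exists_wellConditioned_event`). The orders must differ: the
net must be finer than the ratio of the lower to the upper bound, and with equal orders the two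
requirements on the exponents would be incompatible. -/

/-- The Euclidean norm of a coordinate vector. -/
noncomputable def vnorm {n : ℕ} (v : Fin n → ℝ) : ℝ := ‖WithLp.toLp 2 v‖

/-! ### Euclidean norm of vectors. -/

section VNorm

variable {n m l : ℕ}

lemma vnorm_nonneg (v : Fin n → ℝ) : 0 ≤ vnorm v := norm_nonneg _

@[simp] lemma vnorm_zero : vnorm (0 : Fin n → ℝ) = 0 := by simp [vnorm]

lemma vnorm_sq (v : Fin n → ℝ) : vnorm v ^ 2 = ∑ i, v i ^ 2 := by
  simp [vnorm, EuclideanSpace.norm_sq_eq]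

lemma vnorm_sq_eq_dotProduct (v : Fin n → ℝ) : vnorm v ^ 2 = v ⬝ᵥ v := by
  rw [vnorm_sq]; simp only [dotProduct, sq]

lemma vnorm_eq_zero {v : Fin n → ℝ} : vnorm v = 0 ↔ v = 0 := by
  simp [vnorm]

lemma vnorm_pos {v : Fin n → ℝ} (hv : v ≠ 0) : 0 < vnorm v :=
  (vnorm_nonneg v).lt_of_ne' (by simpa [vnorm_eq_zero] using hv)

lemma vnorm_add_le (v w : Fin n → ℝ) : vnorm (v + w) ≤ vnorm v + vnorm w := by
  simpa [vnorm] using norm_add_le (WithLp.toLp 2 v) (WithLp.toLp 2 w)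

lemma vnorm_smul (c : ℝ) (v : Fin n → ℝ) : vnorm (c • v) = |c| * vnorm v := by
  simp [vnorm, norm_smul]

lemma abs_dotProduct_le (v w : Fin n → ℝ) : |v ⬝ᵥ w| ≤ vnorm v * vnorm w := by
  have := abs_real_inner_le_norm (WithLp.toLp 2 w) (WithLp.toLp 2 v)
  simp only [EuclideanSpace.inner_toLp_toLp, star_trivial] at this
  rw [mul_comm]; exact this

end VNorm

/-! ### Frobenius norm. -/

section Frob

variable {n m l : ℕ}

lemma frobNorm_nonneg (M : Matrix (Fin m) (Fin n) ℝ) : 0 ≤ frobNorm M := Real.sqrt_nonneg _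

lemma frobNorm_sq (M : Matrix (Fin m) (Fin n) ℝ) : frobNorm M ^ 2 = ∑ i, ∑ j, M i j ^ 2 :=
  Real.sq_sqrt (by positivity)

lemma frobNorm_sq_col (M : Matrix (Fin m) (Fin n) ℝ) :
    frobNorm M ^ 2 = ∑ j, vnorm (fun i => M i j) ^ 2 := by
  rw [frobNorm_sq, Finset.sum_comm]; simp [vnorm_sq]

lemma frobNorm_transpose (M : Matrix (Fin m) (Fin n) ℝ) : frobNorm Mᵀ = frobNorm M := by
  unfold frobNorm; rw [Finset.sum_comm]; simp

lemma frobNorm_eq_norm (M : Matrix (Fin m) (Fin n) ℝ) :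
    frobNorm M = ‖WithLp.toLp 2 (fun q : Fin m × Fin n => M q.1 q.2)‖ := by
  rw [EuclideanSpace.norm_eq, frobNorm, Fintype.sum_prod_type]
  simp

lemma frobNorm_smul (c : ℝ) (M : Matrix (Fin m) (Fin n) ℝ) :
    frobNorm (c • M) = |c| * frobNorm M := by
  unfold frobNorm
  rw [← Real.sqrt_sq_eq_abs, ← Real.sqrt_mul (sq_nonneg c), Finset.mul_sum]
  congr 1
  refine Finset.sum_congr rfl fun i _ => ?_
  rw [Finset.mul_sum]
  refine Finset.sum_congr rfl fun j _ => ?_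
  simp [mul_pow]

lemma continuous_frobNorm : Continuous (frobNorm : Matrix (Fin m) (Fin n) ℝ → ℝ) := by
  unfold frobNorm
  refine Real.continuous_sqrt.comp ?_
  refine continuous_finsetSum _ fun i _ => continuous_finsetSum _ fun j _ => ?_
  exact (continuous_id.matrix_elem i j).pow 2

end Frob

/-! ### Operator-norm bounds and well-conditioned matrices. -/

/-- `A` has operator norm at most `c` with respect to the Euclidean norms. -/
def OpBound {m n : ℕ} (A : Matrix (Fin m) (Fin n) ℝ) (c : ℝ) : Prop :=
  ∀ v, vnorm (A *ᵥ v) ≤ c * vnorm v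

section OpBound

variable {n m l : ℕ}

lemma OpBound.mono {A : Matrix (Fin m) (Fin n) ℝ} {c c' : ℝ} (h : OpBound A c) (hc : c ≤ c') :
    OpBound A c' := fun v =>
  (h v).trans (mul_le_mul_of_nonneg_right hc (vnorm_nonneg v))

lemma OpBound.mul {A : Matrix (Fin m) (Fin n) ℝ} {B : Matrix (Fin n) (Fin l) ℝ} {a b : ℝ}
    (ha : 0 ≤ a) (hA : OpBound A a) (hB : OpBound B b) : OpBound (A * B) (a * b) := fun v => by
  rw [← mulVec_mulVec, mul_assoc]
  exact (hA _).trans (mul_le_mul_of_nonneg_left (hB v) ha)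

/-- Cauchy-Schwarz applied to ‖Aᵀv‖² = ⟨v, AAᵀv⟩, followed by cancelling one factor ‖Aᵀv‖. -/
lemma OpBound.transpose {A : Matrix (Fin m) (Fin n) ℝ} {c : ℝ} (hc : 0 ≤ c)
    (h : OpBound A c) : OpBound Aᵀ c := fun v => by
  rcases (vnorm_nonneg (Aᵀ *ᵥ v)).eq_or_lt' with h0 | h0
  · rw [h0]; exact mul_nonneg hc (vnorm_nonneg v)
  · have h1 : vnorm (Aᵀ *ᵥ v) ^ 2 ≤ vnorm v * (c * vnorm (Aᵀ *ᵥ v)) := by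
      rw [vnorm_sq_eq_dotProduct, dotProduct_comm, dotProduct_mulVec, vecMul_transpose, dotProduct_comm]
      exact (le_abs_self _).trans ((abs_dotProduct_le _ _).trans
        (mul_le_mul_of_nonneg_left (h _) (vnorm_nonneg v)))
    nlinarith

lemma opBound_frobNorm (A : Matrix (Fin m) (Fin n) ℝ) : OpBound A (frobNorm A) := fun v => by
  refine le_trans (le_abs_self _) <| abs_le_of_sq_le_sq ?_ (mul_nonneg (frobNorm_nonneg _) (vnorm_nonneg _))
  rw [mul_pow, vnorm_sq, vnorm_sq, frobNorm_sq, Finset.sum_mul]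
  refine Finset.sum_le_sum fun i _ => ?_
  exact Finset.sum_mul_sq_le_sq_mul_sq Finset.univ (fun j => A i j) v

lemma opBound_one : OpBound (1 : Matrix (Fin n) (Fin n) ℝ) 1 := fun v => by simp

lemma OpBound.frobNorm_mul_le {A : Matrix (Fin m) (Fin n) ℝ} {c : ℝ} (hc : 0 ≤ c)
    (h : OpBound A c) (M : Matrix (Fin n) (Fin l) ℝ) : frobNorm (A * M) ≤ c * frobNorm M := by
  refine le_trans (le_abs_self _) <| abs_le_of_sq_le_sq ?_ (mul_nonneg hc (frobNorm_nonneg _))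
  rw [mul_pow, frobNorm_sq_col, frobNorm_sq_col, Finset.mul_sum]
  refine Finset.sum_le_sum fun j _ => ?_
  rw [← mul_pow]
  exact pow_le_pow_left₀ (vnorm_nonneg _) (h (fun i => M i j)) 2

lemma OpBound.frobNorm_mul_transpose_le {A : Matrix (Fin m) (Fin n) ℝ} {c : ℝ} (hc : 0 ≤ c)
    (h : OpBound A c) (M : Matrix (Fin l) (Fin n) ℝ) : frobNorm (M * Aᵀ) ≤ c * frobNorm M := by
  rw [← frobNorm_transpose, transpose_mul, transpose_transpose, ← frobNorm_transpose M]
  exact h.frobNorm_mul_le hc _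

end OpBound

/-- `A` is invertible, and `A` and its inverse have operator norm at most `c`. -/
def TwoSided {n : ℕ} (A : Matrix (Fin n) (Fin n) ℝ) (c : ℝ) : Prop :=
  ∃ A' : Matrix (Fin n) (Fin n) ℝ, A * A' = 1 ∧ A' * A = 1 ∧ OpBound A c ∧ OpBound A' c

section TwoSided

variable {n m l : ℕ}

lemma TwoSided.inv {A A' : Matrix (Fin n) (Fin n) ℝ} {c : ℝ} (h : TwoSided A c)
    (h1 : A * A' = 1) : TwoSided A' c := by
  obtain ⟨A'', e1, e2, b1, b2⟩ := h
  have : A' = A'' := by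
    calc A' = (A'' * A) * A' := by rw [e2, one_mul]
      _ = A'' := by rw [mul_assoc, h1, mul_one]
  subst this
  exact ⟨A, e2, e1, b2, b1⟩

lemma TwoSided.mul {A B : Matrix (Fin n) (Fin n) ℝ} {a b : ℝ} (ha : 0 ≤ a) (hb : 0 ≤ b)
    (hA : TwoSided A a) (hB : TwoSided B b) : TwoSided (A * B) (a * b) := by
  obtain ⟨A', e1, e2, b1, b2⟩ := hA
  obtain ⟨B', f1, f2, c1, c2⟩ := hB
  refine ⟨B' * A', ?_, ?_, b1.mul ha c1, ?_⟩
  · rw [mul_assoc, ← mul_assoc B, f1, one_mul, e1]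
  · rw [mul_assoc, ← mul_assoc A', e2, one_mul, f2]
  · rw [mul_comm a]; exact c2.mul hb b2

lemma TwoSided.of_bounds {A : Matrix (Fin n) (Fin n) ℝ} {c : ℝ}
    (hu : OpBound A c) (hl : ∀ v, vnorm v ≤ c * vnorm (A *ᵥ v)) : TwoSided A c := by
  have hinj : Function.Injective (A *ᵥ ·) := by
    intro v w hvw
    have h1 := hl (v - w)
    have h2 : A *ᵥ (v - w) = 0 := by rw [mulVec_sub]; exact sub_eq_zero.2 hvw
    rw [h2, vnorm_zero, mul_zero] at h1
    exact sub_eq_zero.1 (vnorm_eq_zero.1 (le_antisymm h1 (vnorm_nonneg _)))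
  have hu' : IsUnit A := mulVec_injective_iff_isUnit.1 hinj
  have hdet := (isUnit_iff_isUnit_det A).1 hu'
  refine ⟨A⁻¹, mul_nonsing_inv _ hdet, nonsing_inv_mul _ hdet, hu, fun v => ?_⟩
  have := hl (A⁻¹ *ᵥ v)
  rwa [mulVec_mulVec, mul_nonsing_inv _ hdet, one_mulVec] at this

/-- Multiplying on both sides by well-conditioned matrices changes the Frobenius norm by at most
the product of the bounds. -/
lemma TwoSided.frobNorm_conj_le {A B : Matrix (Fin n) (Fin n) ℝ} {a b : ℝ} (ha : 0 ≤ a)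
    (hb : 0 ≤ b) (hA : TwoSided A a) (hB : TwoSided B b) (M : Matrix (Fin n) (Fin n) ℝ) :
    frobNorm (Aᵀ * M * Bᵀ) ≤ a * b * frobNorm M := by
  obtain ⟨A', -, -, b1, -⟩ := hA
  obtain ⟨B', -, -, c1, -⟩ := hB
  calc frobNorm (Aᵀ * M * Bᵀ) ≤ b * frobNorm (Aᵀ * M) := c1.frobNorm_mul_transpose_le hb _
    _ ≤ b * (a * frobNorm M) :=
      mul_le_mul_of_nonneg_left ((b1.transpose ha).frobNorm_mul_le ha _) hb
    _ = _ := by ring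

lemma TwoSided.le_frobNorm_conj {A B : Matrix (Fin n) (Fin n) ℝ} {a b : ℝ} (ha : 0 ≤ a)
    (hb : 0 ≤ b) (hA : TwoSided A a) (hB : TwoSided B b) (M : Matrix (Fin n) (Fin n) ℝ) :
    frobNorm M ≤ a * b * frobNorm (Aᵀ * M * Bᵀ) := by
  obtain ⟨A', e1, e2, b1, b2⟩ := id hA
  obtain ⟨B', f1, f2, c1, c2⟩ := id hB
  have := (hA.inv e1).frobNorm_conj_le ha hb (hB.inv f1) (Aᵀ * M * Bᵀ)
  have e : A'ᵀ * (Aᵀ * M * Bᵀ) * B'ᵀ = M := by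
    have h1 : A'ᵀ * Aᵀ = 1 := by rw [← transpose_mul, e1, transpose_one]
    have h2 : Bᵀ * B'ᵀ = 1 := by rw [← transpose_mul, f2, transpose_one]
    calc _ = (A'ᵀ * Aᵀ) * M * (Bᵀ * B'ᵀ) := by simp only [mul_assoc]
      _ = M := by rw [h1, h2, one_mul, mul_one]
  rwa [e] at this

end TwoSided

/-! ### Products of layers, their gradients and their stability. -/

section Network

variable {L d : ℕ}

/-- The product `W_k ⋯ W_1` of the first `k` layers. -/
def prefixProd (W : Params L d) (k : ℕ) : Matrix (Fin d) (Fin d) ℝ :=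
  ((List.ofFn W).take k).reverse.prod

/-- The product `W_L ⋯ W_{k+1}` of all layers but the first `k`. -/
def suffixProd (W : Params L d) (k : ℕ) : Matrix (Fin d) (Fin d) ℝ :=
  ((List.ofFn W).drop k).reverse.prod

lemma prefixProd_zero (W : Params L d) : prefixProd W 0 = 1 := by simp [prefixProd]

lemma prefixProd_succ (W : Params L d) {k : ℕ} (hk : k < L) :
    prefixProd W (k + 1) = W ⟨k, hk⟩ * prefixProd W k := by
  unfold prefixProd
  rw [List.take_succ_eq_append_getElem (by simpa using hk)]
  simp

lemma prefixProd_cons (A : Matrix (Fin d) (Fin d) ℝ) (W : Params L d) (k : ℕ) :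
    prefixProd (Fin.cons A W : Params (L + 1) d) (k + 1) = prefixProd W k * A := by
  simp [prefixProd, List.ofFn_succ]

lemma suffixProd_mul_prefixProd (W : Params L d) (k : ℕ) :
    suffixProd W k * prefixProd W k = netMatrix W := by
  unfold prefixProd suffixProd netMatrix
  rw [← List.prod_append, ← List.reverse_append, List.take_append_drop]

lemma prefixProd_length (W : Params L d) : prefixProd W L = netMatrix W := by
  unfold prefixProd netMatrix
  rw [List.take_of_length_le (by simp)]

lemma suffixProd_eq_mul (W : Params L d) (k : Fin L) :
    suffixProd W k = suffixProd W (k + 1) * W k := by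
  unfold suffixProd
  rw [List.drop_eq_getElem_cons (i := (k : ℕ)) (by simp)]
  simp

lemma netMatrix_eq (W : Params L d) (k : Fin L) :
    netMatrix W = suffixProd W (k + 1) * W k * prefixProd W k := by
  rw [← suffixProd_eq_mul, suffixProd_mul_prefixProd]

lemma prefixProd_update (W : Params L d) (k : Fin L) (A : Matrix (Fin d) (Fin d) ℝ) :
    prefixProd (Function.update W k A) k = prefixProd W k := by
  unfold prefixProd
  congr 2
  apply List.ext_getElem (by simp)
  intro i h1 h2
  have hi : i < (k : ℕ) := by simp at h1; omega
  simp only [List.getElem_take, List.getElem_ofFn]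
  rw [Function.update_of_ne]
  intro h; rw [← h] at hi; simp at hi

lemma suffixProd_update (W : Params L d) (k : Fin L) (A : Matrix (Fin d) (Fin d) ℝ) :
    suffixProd (Function.update W k A) (k + 1) = suffixProd W (k + 1) := by
  unfold suffixProd
  congr 2
  apply List.ext_getElem (by simp)
  intro i h1 h2
  simp only [List.getElem_drop, List.getElem_ofFn]
  rw [Function.update_of_ne]
  intro h
  have := congrArg Fin.val h
  simp at this; omega

lemma netMatrix_update (W : Params L d) (k : Fin L) (A : Matrix (Fin d) (Fin d) ℝ) :
    netMatrix (Function.update W k A) = suffixProd W (k + 1) * A * prefixProd W k := by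
  rw [netMatrix_eq _ k, prefixProd_update, suffixProd_update, Function.update_self]

/-- The gradient with respect to the `k`-th layer of a function of the product of the layers,
when that function has gradient `G`. -/
def chainGrad (G : Matrix (Fin d) (Fin d) ℝ → Matrix (Fin d) (Fin d) ℝ) (W : Params L d)
    (k : Fin L) : Matrix (Fin d) (Fin d) ℝ :=
  (suffixProd W (k + 1))ᵀ * G (netMatrix W) * (prefixProd W k)ᵀ

/-- The product of the layers is affine in each single layer, so moving one entry moves the product
along a line. There the exact quadratic expansion of `ρ` gives the derivative directly. -/
lemma layerGrad_comp_netMatrix {ρ : Matrix (Fin d) (Fin d) ℝ → ℝ}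
    {G : Matrix (Fin d) (Fin d) ℝ → Matrix (Fin d) (Fin d) ℝ}
    {q : Matrix (Fin d) (Fin d) ℝ → ℝ}
    (hρ : ∀ M D (t : ℝ), ρ (M + t • D) = ρ M + t * (∑ i, ∑ j, G M i j * D i j) + t ^ 2 * q D)
    (W : Params L d) (k : Fin L) :
    layerGrad (fun W => ρ (netMatrix W)) W k = chainGrad G W k := by
  ext a b
  simp only [layerGrad, of_apply]
  set D : Matrix (Fin d) (Fin d) ℝ :=
    suffixProd W (k + 1) * Matrix.single a b (1 : ℝ) * prefixProd W k with hD
  have h1 : ∀ t : ℝ, netMatrix (W + t • (Pi.single k (Matrix.single a b (1 : ℝ)) : Params L d)) =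
      netMatrix W + t • D := by
    intro t
    have : W + t • (Pi.single k (Matrix.single a b (1 : ℝ)) : Params L d) =
        Function.update W k (W k + t • Matrix.single a b (1 : ℝ)) := by
      ext l : 1
      by_cases hl : l = k
      · subst hl; simp
      · simp [hl]
    rw [this, netMatrix_update, netMatrix_eq W k, mul_add, add_mul]
    simp only [mul_smul_comm, smul_mul_assoc, hD]
  have h2 : HasLineDerivAt ℝ (fun W => ρ (netMatrix W)) (∑ i, ∑ j, G (netMatrix W) i j *
      D i j) W
      (Pi.single k (Matrix.single a b (1 : ℝ))) := by
    unfold HasLineDerivAt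
    simp_rw [h1, hρ]
    have : HasDerivAt _ _ (0 : ℝ) := (((hasDerivAt_id (0 : ℝ)).mul_const (∑ i, ∑ j, G (netMatrix W) i j *
      D i j)).const_add
      (ρ (netMatrix W))).add (((hasDerivAt_id (0 : ℝ)).pow 2).mul_const
      (q D))
    refine HasDerivAt.congr_deriv (this.congr_of_eventuallyEq ?_) (by simp)
    exact Eventually.of_forall fun t => by simp
  rw [h2.lineDeriv]
  have h3 : ∀ i j, D i j =
      suffixProd W (k + 1) i a * prefixProd W k b j := by
    intro i j
    rw [hD, Matrix.mul_apply, Finset.sum_eq_single b]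
    · simp
    · intro x _ hx; simp [hx]
    · simp
  simp_rw [h3, chainGrad, Matrix.mul_apply, transpose_apply, Finset.sum_mul]
  rw [Finset.sum_comm]
  refine Finset.sum_congr rfl fun i _ => Finset.sum_congr rfl fun j _ => ?_
  ring

/-- Prefix products of nearby weights are as well-conditioned as the original ones. -/
lemma prefixProd_twoSided_of_near {W₀ W : Params L d} {A η : ℝ} (hA : 0 < A) (hη : 0 ≤ η)
    (hAη : A ^ 2 * η ≤ 1 / 2) (h₀ : ∀ k ≤ L, TwoSided (prefixProd W₀ k) A)
    (h : ∀ k, frobNorm (W k - W₀ k) ≤ η / L) {k : ℕ} (hk : k ≤ L) :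
    TwoSided (prefixProd W k) (2 * A) := by
  have hL0 : (0 : ℝ) ≤ L := Nat.cast_nonneg L
  set e : ℝ := A * (η / L) * A with he
  have he0 : 0 ≤ e := by positivity
  have heL : L * e ≤ 1 / 2 := by
    rcases hL0.eq_or_lt' with h0 | h0
    · rw [h0]; norm_num
    · have : L * e = A ^ 2 * η := by rw [he]; field_simp
      rw [this]; exact hAη
  -- The perturbation is factored out on the right: `Z` gains a factor 1 + E per layer, with E = (W₀
  -- prefix at k+1)⁻¹ (W k - W₀ k) (W₀ prefix at k). Each E has norm at most e = A²η/L, so L factors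
  -- accumulate only a bounded distortion.
  have key : ∀ k ≤ L, ∃ Z : Matrix (Fin d) (Fin d) ℝ, prefixProd W k = prefixProd W₀ k * Z ∧
      OpBound Z ((1 + e) ^ k) ∧ ∀ v, (1 - k * e) * vnorm v ≤ vnorm (Z *ᵥ v) := by
    intro k
    induction k with
    | zero => intro _; exact ⟨1, by simp [prefixProd_zero], by simpa using opBound_one, by simp⟩
    | succ k ih =>
      intro hk
      obtain ⟨Z, hZ, hu, hl⟩ := ih (by omega)
      obtain ⟨V, e1, e2, b1, b2⟩ := h₀ (k + 1) hk
      obtain ⟨-, -, -, b3, -⟩ := h₀ k (by omega)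
      set E := V * (W ⟨k, hk⟩ - W₀ ⟨k, hk⟩) * prefixProd W₀ k with hE
      have hEb : OpBound E e :=
        (b2.mul hA.le ((opBound_frobNorm _).mono (h ⟨k, hk⟩))).mul (by positivity) b3
      have hk' : (((k + 1 : ℕ)) : ℝ) * e ≤ 1 / 2 :=
        (mul_le_mul_of_nonneg_right (by exact_mod_cast hk) he0).trans heL
      push_cast at hk'
      refine ⟨(1 + E) * Z, ?_, ?_, ?_⟩
      · rw [← mul_assoc, mul_add, mul_one, hE, ← mul_assoc, ← mul_assoc, e1, one_mul,
          prefixProd_succ W hk, prefixProd_succ W₀ hk, hZ, sub_mul, add_sub_cancel, mul_assoc]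
      · rw [pow_succ']
        refine OpBound.mul (by positivity) (fun v => ?_) hu
        rw [add_mulVec, one_mulVec, add_mul, one_mul]
        exact (vnorm_add_le _ _).trans (add_le_add_right (hEb v) _)
      · intro v
        rw [← mulVec_mulVec]
        have h1 : (1 - e) * vnorm (Z *ᵥ v) ≤ vnorm ((1 + E) *ᵥ (Z *ᵥ v)) := by
          have h2 := vnorm_add_le ((1 + E) *ᵥ (Z *ᵥ v)) (-(E *ᵥ (Z *ᵥ v)))
          have h3 : vnorm (-(E *ᵥ (Z *ᵥ v))) = vnorm (E *ᵥ (Z *ᵥ v)) := by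
            simp [vnorm]
          rw [add_mulVec, one_mulVec, add_neg_cancel_right, h3] at h2
          rw [add_mulVec, one_mulVec]
          linarith [hEb (Z *ᵥ v)]
        refine le_trans ?_ h1
        have h4 := mul_le_mul_of_nonneg_left (hl v) (by nlinarith [mul_nonneg (Nat.cast_nonneg k : (0:ℝ) ≤ k) he0] : 0 ≤ 1 - e)
        refine le_trans ?_ h4
        have h5 : 1 - ((k + 1 : ℕ) : ℝ) * e ≤ (1 - e) * (1 - k * e) := by
          push_cast
          nlinarith [mul_nonneg (Nat.cast_nonneg k : (0:ℝ) ≤ k) (mul_self_nonneg e)]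
        simpa only [mul_assoc] using mul_le_mul_of_nonneg_right h5 (vnorm_nonneg v)
  obtain ⟨Z, hZ, hu, hl⟩ := key k hk
  have hke : (k : ℝ) * e ≤ 1 / 2 :=
    (mul_le_mul_of_nonneg_right (by exact_mod_cast hk) he0).trans heL
  rw [hZ]
  have hpow : (1 + e) ^ k ≤ 2 := by
    have h1 : (1 + e) ^ k ≤ Real.exp (k * e) := by
      rw [Real.exp_nat_mul]
      exact pow_le_pow_left₀ (by positivity) (by linarith [Real.add_one_le_exp e]) k
    have h2 : Real.exp (1 / 2) ≤ 2 := by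
      refine le_trans (le_abs_self _) <| abs_le_of_sq_le_sq ?_ (by norm_num)
      rw [← Real.exp_nat_mul]
      have := Real.exp_one_lt_d9
      norm_num at this ⊢
      linarith
    exact h1.trans ((Real.exp_le_exp.2 hke).trans h2)
  rw [mul_comm (2 : ℝ)]
  refine TwoSided.mul hA.le (by norm_num) (h₀ k hk)
    (TwoSided.of_bounds (hu.mono hpow) fun v => ?_)
  have := mul_le_mul_of_nonneg_right (by linarith : (1 : ℝ) / 2 ≤ 1 - k * e) (vnorm_nonneg v)
  linarith [hl v]

/-- A suffix product is the full product times the inverse of a prefix product. Hence only prefix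
products need probabilistic control. -/
lemma suffixProd_twoSided {W : Params L d} {B : ℝ} (hB : 0 ≤ B)
    (h : ∀ k ≤ L, TwoSided (prefixProd W k) B) {k : ℕ} (hk : k ≤ L) :
    TwoSided (suffixProd W k) (B * B) := by
  obtain ⟨V, e1, e2, b1, b2⟩ := id (h k hk)
  have : suffixProd W k = prefixProd W L * V := by
    rw [prefixProd_length, ← suffixProd_mul_prefixProd W k, mul_assoc, e1, mul_one]
  rw [this]
  exact (h L le_rfl).mul hB hB ((h k hk).inv e1)

end Network

/-! ### Global existence and uniqueness for forward flows. -/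

section ODE

/-- A continuous curve which lies in the open subset `U` of the closed set `S` whenever it has
stayed in `S` so far never leaves `S`. -/
lemma mem_of_bootstrap {E : Type*} [TopologicalSpace E] {S U : Set E} (hS : IsClosed S) (hU : IsOpen U) (hUS : U ⊆ S)
    {u : ℝ → E} (hu : ContinuousOn u (Set.Ici 0)) (h0 : u 0 ∈ S)
    (h : ∀ T, 0 ≤ T → (∀ t ∈ Set.Icc 0 T, u t ∈ S) → u T ∈ U) {t : ℝ} (ht : 0 ≤ t) : u t ∈ S := by
  by_contra hbad
  set A : Set ℝ := {t | 0 ≤ t ∧ u t ∉ S} with hA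
  have hne : A.Nonempty := ⟨t, ht, hbad⟩
  have hbdd : BddBelow A := ⟨0, fun s hs => hs.1⟩
  -- At this infimum of exit times, closedness of `S` keeps the curve in `S`, so the hypothesis puts
  -- it in the open set `U`. It then remains in `S` slightly longer, which is a contradiction.
  set T := sInf A with hT
  have hT0 : 0 ≤ T := le_csInf hne fun s hs => hs.1
  have hlt : ∀ s, 0 ≤ s → s < T → u s ∈ S := fun s hs hsT => by
    by_contra hc
    exact absurd (csInf_le hbdd (⟨hs, hc⟩ : s ∈ A)) (not_le.2 hsT)
  have hTS : u T ∈ S := by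
    rcases hT0.eq_or_lt with h1 | h1
    · rw [← h1]; exact h0
    · have hc : Tendsto u (𝓝[Set.Ico 0 T] T) (𝓝 (u T)) :=
        ((hu T hT0).mono fun s hs => hs.1)
      have : (𝓝[Set.Ico 0 T] T).NeBot := by
        rw [← mem_closure_iff_nhdsWithin_neBot, closure_Ico h1.ne]
        exact ⟨hT0, le_rfl⟩
      exact hS.mem_of_tendsto hc
        (eventually_mem_nhdsWithin.mono fun s hs => hlt s hs.1 hs.2)
  have hTU : u T ∈ U := h T hT0 fun s hs => by
    rcases hs.2.eq_or_lt with h1 | h1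
    · rw [h1]; exact hTS
    · exact hlt s hs.1 h1
  have hev : ∀ᶠ s in 𝓝[Set.Ici 0] T, u s ∈ U := (hu T hT0) (hU.mem_nhds hTU)
  obtain ⟨ε, hε, hball⟩ := Metric.mem_nhdsWithin_iff.1 hev
  obtain ⟨s, hsA, hs⟩ := exists_lt_of_csInf_lt hne (show sInf A < T + ε by linarith)
  have hTs : T ≤ s := csInf_le hbdd hsA
  refine hsA.2 (hUS (hball ⟨?_, hsA.1⟩))
  rw [Metric.mem_ball, Real.dist_eq, abs_of_nonneg (by linarith)]
  linarith

variable {E : Type*} [NormedAddCommGroup E] [NormedSpace ℝ E]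

/-- `u` is an integral curve of the vector field `F` on `[0, ∞)` starting at `x`. -/
def IsForwardFlow (F : E → E) (x : E) (u : ℝ → E) : Prop :=
  u 0 = x ∧ ∀ t : ℝ, 0 ≤ t → HasDerivWithinAt u (F (u t)) (Set.Ici 0) t

lemma IsForwardFlow.continuousOn {F : E → E} {x : E} {u : ℝ → E} (h : IsForwardFlow F x u) :
    ContinuousOn u (Set.Ici 0) := fun t ht => (h.2 t ht).continuousWithinAt

/-- A bounded Lipschitz vector field has global forward integral curves. -/
lemma exists_isForwardFlow_of_lipschitz [CompleteSpace E] {F : E → E} {K : NNReal}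
    (hK : LipschitzWith K F) {C : NNReal} (hC : ∀ x, ‖F x‖ ≤ C) (x : E) :
    ∃ u, IsForwardFlow F x u := by
  have hloc : ∀ n : ℕ, ∃ u : ℝ → E, u 0 = x ∧
      ∀ t ∈ Set.Icc (0 : ℝ) n, HasDerivWithinAt u (F (u t)) (Set.Icc (0 : ℝ) n) t := by
    intro n
    have h0 : (0 : ℝ) ∈ Set.Icc (0 : ℝ) n := ⟨le_rfl, Nat.cast_nonneg n⟩
    have hPL : IsPicardLindelof (fun _ => F) (⟨0, h0⟩ : Set.Icc (0 : ℝ) n) x (C * n) 0 C K := by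
      refine IsPicardLindelof.of_time_independent (fun y _ => hC y) hK.lipschitzOnWith ?_
      simp
    exact hPL.exists_eq_forall_mem_Icc_hasDerivWithinAt₀
  choose f hf0 hf using hloc
  have hIci : ∀ (n : ℕ) (t : ℝ), 0 ≤ t → t < n →
      HasDerivWithinAt (f n) (F (f n t)) (Set.Ici 0) t := fun n t h0 hn =>
    (hf n t ⟨h0, hn.le⟩).mono_of_mem_nhdsWithin (by
      rw [mem_nhdsWithin]
      exact ⟨Set.Iio n, isOpen_Iio, hn, fun y hy => ⟨hy.2, hy.1.le⟩⟩)
  have hagree : ∀ (m n : ℕ) (t : ℝ), m ≤ n → 0 ≤ t → t ≤ m → f m t = f n t := by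
    intro m n t hmn h0 hm
    have hmn' : (m : ℝ) ≤ n := by exact_mod_cast hmn
    refine ODE_solution_unique_of_mem_Icc_right (v := fun _ => F) (s := fun _ => Set.univ)
      (K := K) (a := 0) (b := m) (fun _ _ => hK.lipschitzOnWith) (fun s hs => (hf m s hs).continuousWithinAt)
      (fun s hs => (hIci m s hs.1 hs.2).mono (Set.Ici_subset_Ici.2 hs.1)) (fun _ _ => trivial)
      (fun s hs => ((hf n s ⟨hs.1, hs.2.trans hmn'⟩).mono
        (Set.Icc_subset_Icc_right hmn')).continuousWithinAt)
      (fun s hs => (hIci n s hs.1 (hs.2.trans_le hmn')).mono (Set.Ici_subset_Ici.2 hs.1))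
      (fun _ _ => trivial) ?_ ⟨h0, hm⟩
    rw [hf0, hf0]
  -- The extra 1 puts `t` strictly before the end of the interval of the chosen local solution, so
  -- the derivative within the interval is one within `Set.Ici 0`.
  refine ⟨fun t => f (⌈t⌉₊ + 1) t, by simp [hf0], fun t ht => ?_⟩
  have hlt : t < (⌈t⌉₊ + 1 : ℕ) := by
    push_cast; linarith [Nat.le_ceil t]
  refine (hIci _ t ht hlt).congr_of_eventuallyEq ?_ rfl
  have : Set.Iio ((⌈t⌉₊ + 1 : ℕ) : ℝ) ∈ 𝓝 t := Iio_mem_nhds hlt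
  filter_upwards [mem_nhdsWithin_of_mem_nhds this, self_mem_nhdsWithin] with s hs hs0
  rcases le_total (⌈s⌉₊ + 1) (⌈t⌉₊ + 1) with hst | hst
  · exact hagree _ _ s hst hs0 (by push_cast; linarith [Nat.le_ceil s])
  · exact (hagree _ _ s hst hs0 (le_of_lt hs)).symm

/-- Integral curves of a `C¹` vector field are determined by their initial value. -/
lemma IsForwardFlow.unique [FiniteDimensional ℝ E] {F : E → E} (hF : ContDiff ℝ 1 F) {x : E}
    {u v : ℝ → E} (hu : IsForwardFlow F x u) (hv : IsForwardFlow F x v) {t : ℝ} (ht : 0 ≤ t) :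
    u t = v t := by
  have hcu : ContinuousOn u (Set.Icc 0 t) := hu.continuousOn.mono fun s hs => hs.1
  have hcv : ContinuousOn v (Set.Icc 0 t) := hv.continuousOn.mono fun s hs => hs.1
  obtain ⟨R, hR⟩ := ((isCompact_Icc.image_of_continuousOn hcu).union
    (isCompact_Icc.image_of_continuousOn hcv)).isBounded.subset_closedBall 0
  obtain ⟨K, hK⟩ := hF.contDiffOn.exists_lipschitzOnWith (s := Metric.closedBall (0 : E) R)
    one_ne_zero (convex_closedBall _ _) (isCompact_closedBall _ _)
  refine ODE_solution_unique_of_mem_Icc_right (v := fun _ => F)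
    (s := fun _ => Metric.closedBall (0 : E) R) (K := K) (a := 0) (b := t) (fun _ _ => hK) hcu
    (fun s hs => (hu.2 s hs.1).mono (Set.Ici_subset_Ici.2 hs.1))
    (fun s hs => hR (Or.inl ⟨s, ⟨hs.1, hs.2.le⟩, rfl⟩)) hcv
    (fun s hs => (hv.2 s hs.1).mono (Set.Ici_subset_Ici.2 hs.1))
    (fun s hs => hR (Or.inr ⟨s, ⟨hs.1, hs.2.le⟩, rfl⟩)) ?_ ⟨ht, le_rfl⟩
  rw [hu.1, hv.1]

/-- If integral curves of a `C¹` vector field cannot leave the closed bounded set `S` by the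
bootstrap principle, then they exist globally and stay in `S`. -/
lemma isForwardFlow_of_bootstrap [FiniteDimensional ℝ E] {F : E → E} (hF : ContDiff ℝ 1 F)
    {S U : Set E} (hS : IsClosed S) (hSb : Bornology.IsBounded S) (hU : IsOpen U) (hUS : U ⊆ S)
    {x : E} (hx : x ∈ S)
    (h : ∀ (u : ℝ → E) (T : ℝ), 0 ≤ T → u 0 = x →
      (∀ t ∈ Set.Icc 0 T, u t ∈ S ∧ HasDerivWithinAt u (F (u t)) (Set.Ici 0) t) → u T ∈ U) :
    (∃ u, IsForwardFlow F x u) ∧ ∀ u, IsForwardFlow F x u → ∀ t, 0 ≤ t → u t ∈ S := by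
  constructor
  · have : CompleteSpace E := FiniteDimensional.complete ℝ E
    obtain ⟨R, hR⟩ := hSb.subset_closedBall 0
    -- A cutoff equal to 1 on `S` makes the field bounded and Lipschitz without changing it on `S`.
    -- The bootstrap confines the resulting curve to `S`, so it solves the original equation.
    let b : ContDiffBump (0 : E) := ⟨max R 1, max R 1 + 1, by positivity, by linarith⟩
    set F' : E → E := fun y => b y • F y with hF'
    have hF'c : ContDiff ℝ 1 F' := b.contDiff.smul hF
    have hsupp : HasCompactSupport F' := b.hasCompactSupport.smul_right
    obtain ⟨K, hK⟩ := ContDiff.lipschitzWith_of_hasCompactSupport (𝕂 := ℝ) hsupp hF'c one_ne_zero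
    obtain ⟨C, hC⟩ := hsupp.exists_bound_of_continuous hF'c.continuous
    have hFS : ∀ y ∈ S, F' y = F y := fun y hy => by
      have : y ∈ Metric.closedBall (0 : E) b.rIn :=
        Metric.closedBall_subset_closedBall (le_max_left R 1) (hR hy)
      simp only [hF', b.one_of_mem_closedBall this, one_smul]
    obtain ⟨u, hu⟩ := exists_isForwardFlow_of_lipschitz hK (C := Real.toNNReal C)
      (fun y => (hC y).trans (Real.le_coe_toNNReal C)) x
    have hmem : ∀ t, 0 ≤ t → u t ∈ S := fun t ht =>
      mem_of_bootstrap hS hU hUS hu.continuousOn (hu.1.symm ▸ hx) (fun T hT hin =>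
        h u T hT hu.1 fun s hs => ⟨hin s hs, hFS _ (hin s hs) ▸ hu.2 s hs.1⟩) ht
    exact ⟨u, hu.1, fun t ht => hFS _ (hmem t ht) ▸ hu.2 t ht⟩
  · intro u hu t ht
    exact mem_of_bootstrap hS hU hUS hu.continuousOn (hu.1.symm ▸ hx) (fun T hT hin =>
        h u T hT hu.1 fun s hs => ⟨hin s hs, hu.2 s hs.1⟩) ht

end ODE

/-! ### Smoothness of the risk and its gradient in the weights. -/

section Smoothness

variable {L d : ℕ}

/-- Weights as a plain array of numbers, a type which carries a normed space structure. -/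
def ofArray (w : Fin L → Fin d → Fin d → ℝ) : Params L d := fun k => Matrix.of (w k)

lemma contDiff_list_prod (l : List (Fin L)) (i j : Fin d) :
    ContDiff ℝ 1 (fun w : Fin L → Fin d → Fin d → ℝ => ((l.map (ofArray w)).prod) i j) := by
  induction l generalizing i j with
  | nil => simpa using contDiff_const
  | cons a l ih =>
    simp only [List.map_cons, List.prod_cons, Matrix.mul_apply]
    refine ContDiff.sum fun x _ => ContDiff.mul ?_ (ih x j)
    exact (contDiff_apply_apply ℝ ℝ i x).comp (contDiff_apply ℝ (Fin d → Fin d → ℝ) a)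

lemma contDiff_prefixProd (k : ℕ) (i j : Fin d) :
    ContDiff ℝ 1 (fun w : Fin L → Fin d → Fin d → ℝ => prefixProd (ofArray w) k i j) := by
  have := contDiff_list_prod ((List.finRange L).take k).reverse i j
  simpa only [prefixProd, List.ofFn_eq_map, List.map_take, List.map_reverse] using this

lemma contDiff_suffixProd (k : ℕ) (i j : Fin d) :
    ContDiff ℝ 1 (fun w : Fin L → Fin d → Fin d → ℝ => suffixProd (ofArray w) k i j) := by
  have := contDiff_list_prod ((List.finRange L).drop k).reverse i j
  simpa only [suffixProd, List.ofFn_eq_map, List.map_drop, List.map_reverse] using this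

lemma contDiff_netMatrix :
    ContDiff ℝ 1 (fun (w : Fin L → Fin d → Fin d → ℝ) i j => netMatrix (ofArray w) i j) := by
  simp_rw [← prefixProd_length]
  exact contDiff_pi.2 fun i => contDiff_pi.2 fun j => contDiff_prefixProd L i j

lemma contDiff_comp_netMatrix {ρ : Matrix (Fin d) (Fin d) ℝ → ℝ}
    (hρ : ContDiff ℝ 1 (fun M : Fin d → Fin d → ℝ => ρ (Matrix.of M))) :
    ContDiff ℝ 1 (fun w : Fin L → Fin d → Fin d → ℝ => ρ (netMatrix (ofArray w))) :=
  hρ.comp contDiff_netMatrix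

lemma contDiff_chainGrad {G : Matrix (Fin d) (Fin d) ℝ → Matrix (Fin d) (Fin d) ℝ}
    (hG : ∀ i j, ContDiff ℝ 1 (fun M : Fin d → Fin d → ℝ => G (Matrix.of M) i j)) :
    ContDiff ℝ 1 (fun (w : Fin L → Fin d → Fin d → ℝ) k i j => -(chainGrad G (ofArray w) k i j)) := by
  refine contDiff_pi.2 fun k => contDiff_pi.2 fun i => contDiff_pi.2 fun j => ContDiff.neg ?_
  simp only [chainGrad, Matrix.mul_apply, transpose_apply]
  exact ContDiff.sum fun x _ => (ContDiff.sum fun y _ => (contDiff_suffixProd _ _ _).mul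
    (contDiff_comp_netMatrix
    (ρ := fun M => G M y x) (hG y x))).mul (contDiff_prefixProd _ _ _)

/-- The derivative of a function of the weights is the pairing with its partial gradients. -/
lemma fderiv_eq_sum_layerGrad {R : Params L d → ℝ}
    (hR : ContDiff ℝ 1 (fun w : Fin L → Fin d → Fin d → ℝ => R (ofArray w)))
    (w v : Fin L → Fin d → Fin d → ℝ) :
    fderiv ℝ (fun w => R (ofArray w)) w v =
      ∑ k, ∑ i, ∑ j, v k i j * layerGrad R (ofArray w) k i j := by
  have hv : v = ∑ k, ∑ i, ∑ j, v k i j •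
      (Pi.single k (Pi.single i (Pi.single j (1 : ℝ))) : Fin L → Fin d → Fin d → ℝ) := by
    ext a b c
    simp [Finset.sum_apply, Pi.single_apply, Finset.sum_ite_eq, ite_apply]
  conv_lhs => rw [hv]
  simp only [map_sum, map_smul, smul_eq_mul]
  refine Finset.sum_congr rfl fun k _ => Finset.sum_congr rfl fun i _ =>
    Finset.sum_congr rfl fun j _ => ?_
  congr 1
  rw [← (hR.differentiable one_ne_zero w).lineDeriv_eq_fderiv]
  simp only [layerGrad, of_apply, Matrix.single_eq_of_single_single]
  rfl

/-- Passes from the entrywise formulation to an integral curve in the normed space of arrays, where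
the flow lemmas apply. -/
lemma isGradientFlow_iff {R : Params L d → ℝ} {F : Params L d → Params L d}
    (hRF : ∀ W k, layerGrad R W k = F W k) {w₀ : Fin L → Fin d → Fin d → ℝ}
    {w : ℝ → Fin L → Fin d → Fin d → ℝ} :
    IsGradientFlow R (ofArray w₀) (fun t => ofArray (w t)) ↔
      IsForwardFlow (fun v k i j => -(F (ofArray v) k i j)) w₀ w := by
  unfold IsGradientFlow IsForwardFlow
  refine and_congr Iff.rfl (forall₂_congr fun t _ => ?_)
  simp_rw [hRF]
  constructor
  · intro h
    exact hasDerivWithinAt_pi.2 fun k => hasDerivWithinAt_pi.2 fun i =>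
      hasDerivWithinAt_pi.2 fun j => h k i j
  · intro h k i j
    exact hasDerivWithinAt_pi.1 (hasDerivWithinAt_pi.1 (hasDerivWithinAt_pi.1 h k) i) j

end Smoothness

/-! ### Risk decay and travelled distance along the flow. -/

section GradientFlow

variable {L d : ℕ}

/-- `ρ` has gradient `G`, both are smooth, and the squared gradient norm is comparable to the
excess over `m`. -/
structure IsComparable (ρ : Matrix (Fin d) (Fin d) ℝ → ℝ)
    (G : Matrix (Fin d) (Fin d) ℝ → Matrix (Fin d) (Fin d) ℝ) (m α β : ℝ) : Prop where
  expand : ∃ q : Matrix (Fin d) (Fin d) ℝ → ℝ, ∀ M D (t : ℝ),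
    ρ (M + t • D) = ρ M + t * (∑ i, ∑ j, G M i j * D i j) + t ^ 2 * q D
  contDiff : ContDiff ℝ 1 (fun M : Fin d → Fin d → ℝ => ρ (Matrix.of M))
  contDiff_grad : ∀ i j, ContDiff ℝ 1 (fun M : Fin d → Fin d → ℝ => G (Matrix.of M) i j)
  alpha_pos : 0 < α
  beta_pos : 0 < β
  le_grad : ∀ M, 4 * α * (ρ M - m) ≤ frobNorm (G M) ^ 2
  grad_le : ∀ M, frobNorm (G M) ^ 2 ≤ 4 * β * (ρ M - m)

variable {ρ : Matrix (Fin d) (Fin d) ℝ → ℝ}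
    {G : Matrix (Fin d) (Fin d) ℝ → Matrix (Fin d) (Fin d) ℝ} {m α β : ℝ}

lemma IsComparable.layerGrad_eq (h : IsComparable ρ G m α β) (W : Params L d) (k : Fin L) :
    layerGrad (fun W => ρ (netMatrix W)) W k = chainGrad G W k := by
  obtain ⟨q, hq⟩ := h.expand
  exact layerGrad_comp_netMatrix hq W k

lemma IsComparable.le (h : IsComparable ρ G m α β) (M : Matrix (Fin d) (Fin d) ℝ) : m ≤ ρ M := by
  have := (sq_nonneg _).trans (h.grad_le M)
  have hb := h.beta_pos
  by_contra hc
  push Not at hc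
  nlinarith [mul_pos hb (sub_pos.2 hc)]

/-- All partial gradients at `W` are comparable to the gradient at the product of the layers. -/
def WellConditioned (G : Matrix (Fin d) (Fin d) ℝ → Matrix (Fin d) (Fin d) ℝ) (b : ℝ)
    (W : Params L d) : Prop :=
  ∀ k, frobNorm (G (netMatrix W)) ≤ b * frobNorm (chainGrad G W k) ∧
    frobNorm (chainGrad G W k) ≤ b * frobNorm (G (netMatrix W))

/-- Along a well-conditioned stretch of the gradient flow the excess risk decays exponentially. -/
lemma IsComparable.excess_le (h : IsComparable ρ G m α β) {b : ℝ} (hb : 0 < b)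
    {u : ℝ → Fin L → Fin d → Fin d → ℝ} {T : ℝ}
    (hu : ∀ t ∈ Set.Icc 0 T, WellConditioned G b (ofArray (u t)) ∧
      HasDerivWithinAt u (fun k i j => -(chainGrad G (ofArray (u t)) k i j)) (Set.Ici 0) t)
    {t : ℝ} (ht : t ∈ Set.Icc 0 T) :
    ρ (netMatrix (ofArray (u t))) - m ≤
      (ρ (netMatrix (ofArray (u 0))) - m) * Real.exp (-(4 * L * α / b ^ 2 * t)) := by
  set μ := 4 * L * α / b ^ 2 with hμ
  set f : ℝ → ℝ := fun t => ρ (netMatrix (ofArray (u t))) - m with hf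
  have hRs : ContDiff ℝ 1 (fun w : Fin L → Fin d → Fin d → ℝ => ρ (netMatrix (ofArray w))) :=
    contDiff_comp_netMatrix h.contDiff
  have hfd : ∀ t ∈ Set.Icc 0 T, HasDerivWithinAt f
      (-∑ k, frobNorm (chainGrad G (ofArray (u t)) k) ^ 2) (Set.Ici 0) t := by
    intro t ht
    have h1 := ((hRs.differentiable one_ne_zero (u t)).hasFDerivAt.comp_hasDerivWithinAt t
      (hu t ht).2).sub_const m
    refine h1.congr_deriv ?_
    rw [fderiv_eq_sum_layerGrad (R := fun W => ρ (netMatrix W)) hRs]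
    simp only [h.layerGrad_eq, frobNorm_sq, ← Finset.sum_neg_distrib]
    refine Finset.sum_congr rfl fun k _ => Finset.sum_congr rfl fun i _ =>
      Finset.sum_congr rfl fun j _ => ?_
    ring
  have hdec : ∀ t ∈ Set.Icc 0 T,
      μ * f t ≤ ∑ k, frobNorm (chainGrad G (ofArray (u t)) k) ^ 2 := by
    intro t ht
    -- Every layer contributes its own share of dissipation; summing over the `L` layers produces
    -- the factor `L` in the decay rate.
    have hk : ∀ k ∈ Finset.univ, 4 * α * f t / b ^ 2 ≤
        frobNorm (chainGrad G (ofArray (u t)) k) ^ 2 := by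
      intro k _
      rw [div_le_iff₀ (by positivity), ← mul_pow, mul_comm _ b]
      exact (h.le_grad _).trans (pow_le_pow_left₀ (frobNorm_nonneg _) ((hu t ht).1 k).1 2)
    have := Finset.card_nsmul_le_sum Finset.univ _ _ hk
    simp only [Finset.card_univ, Fintype.card_fin, nsmul_eq_mul] at this
    refine le_trans (le_of_eq ?_) this
    rw [hμ]; ring
  have hanti : AntitoneOn (fun t => Real.exp (μ * t) * f t) (Set.Icc 0 T) := by
    have hd : ∀ t ∈ Set.Icc 0 T, HasDerivWithinAt (fun t => Real.exp (μ * t) * f t)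
        (Real.exp (μ * t) * μ * f t + Real.exp (μ * t) *
          (-∑ k, frobNorm (chainGrad G (ofArray (u t)) k) ^ 2)) (Set.Ici 0) t := by
      intro t ht
      have h1 : HasDerivAt (fun t => Real.exp (μ * t)) (Real.exp (μ * t) * μ) t := by
        simpa using ((hasDerivAt_id t).const_mul μ).exp
      exact h1.hasDerivWithinAt.mul (hfd t ht)
    refine antitoneOn_of_hasDerivWithinAt_nonpos (convex_Icc 0 T)
      (fun t ht => ((hd t ht).continuousWithinAt).mono fun s hs => hs.1)
      (fun t ht => (hd t (interior_subset ht)).mono fun s hs => (interior_subset hs).1)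
      fun t ht => ?_
    have := hdec t (interior_subset ht)
    nlinarith [Real.exp_pos (μ * t)]
  have := hanti ⟨le_rfl, ht.1.trans ht.2⟩ ht ht.1
  simp only [mul_zero, Real.exp_zero, one_mul] at this
  rw [Real.exp_neg, ← div_eq_mul_inv, le_div_iff₀ (Real.exp_pos _), mul_comm]
  exact this

/-- Along a well-conditioned stretch of the gradient flow each layer travels a distance bounded
by the square root of the initial excess risk. -/
lemma IsComparable.frobNorm_sub_le (h : IsComparable ρ G m α β) (hL : 0 < L) {b : ℝ} (hb : 0 < b)
    {u : ℝ → Fin L → Fin d → Fin d → ℝ} {T : ℝ}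
    (hu : ∀ t ∈ Set.Icc 0 T, WellConditioned G b (ofArray (u t)) ∧
      HasDerivWithinAt u (fun k i j => -(chainGrad G (ofArray (u t)) k i j)) (Set.Ici 0) t)
    {s t : ℝ} (hs : 0 ≤ s) (hst : s ≤ t) (ht : t ≤ T) (k : Fin L) :
    frobNorm (ofArray (u t) k - ofArray (u s) k) ≤
      b ^ 3 * Real.sqrt (β * (ρ (netMatrix (ofArray (u 0))) - m)) / (L * α) *
        (Real.exp (-(2 * L * α / b ^ 2 * s)) - Real.exp (-(2 * L * α / b ^ 2 * t))) := by
  have hL' : (0 : ℝ) < L := by exact_mod_cast hL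
  have hα := h.alpha_pos
  have hβ := h.beta_pos
  set f0 := ρ (netMatrix (ofArray (u 0))) - m with hf0
  have hf00 : 0 ≤ f0 := sub_nonneg.2 (h.le _)
  set ν := 2 * L * α / b ^ 2 with hν
  have hν0 : 0 < ν := by positivity
  -- `ν` is half the decay rate of the excess, hence the decay rate of the gradient. `c` is the
  -- initial speed bound 2b√(βf0) divided by `ν`, that is, the bound on the total length travelled.
  set c := b ^ 3 * Real.sqrt (β * f0) / (L * α) with hc
  have hc' : c * ν = b * (2 * Real.sqrt (β * f0)) := by
    rw [hc, hν]; field_simp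
  let g : ℝ → EuclideanSpace ℝ (Fin d × Fin d) :=
    fun τ => WithLp.toLp 2 (fun q => u τ k q.1 q.2 - u s k q.1 q.2)
  let g' : ℝ → EuclideanSpace ℝ (Fin d × Fin d) :=
    fun τ => WithLp.toLp 2 (fun q => -(chainGrad G (ofArray (u τ)) k q.1 q.2))
  have hg : ∀ τ ∈ Set.Icc 0 T, HasDerivWithinAt g (g' τ) (Set.Ici 0) τ := by
    intro τ hτ
    have h1 : HasDerivWithinAt (fun τ (q : Fin d × Fin d) => u τ k q.1 q.2 - u s k q.1 q.2)
        (fun q => -(chainGrad G (ofArray (u τ)) k q.1 q.2)) (Set.Ici 0) τ :=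
      hasDerivWithinAt_pi.2 fun q => (hasDerivWithinAt_pi.1 (hasDerivWithinAt_pi.1
        (hasDerivWithinAt_pi.1 (hu τ hτ).2 k) q.1) q.2).sub_const _
    exact (PiLp.continuousLinearEquiv 2 ℝ (fun _ : Fin d × Fin d => ℝ)).symm.hasFDerivAt
      |>.comp_hasDerivWithinAt τ h1
  have hg'n : ∀ τ ∈ Set.Icc 0 T, ‖g' τ‖ ≤ c * ν * Real.exp (-(ν * τ)) := by
    intro τ hτ
    have e1 : ‖g' τ‖ = frobNorm (chainGrad G (ofArray (u τ)) k) := by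
      rw [frobNorm_eq_norm, ← norm_neg]; congr 1; ext q; simp [g']
    rw [e1, hc']
    have e2 := ((hu τ hτ).1 k).2
    have e3 : frobNorm (G (netMatrix (ofArray (u τ)))) ≤
        2 * Real.sqrt (β * f0) * Real.exp (-(ν * τ)) := by
      refine le_trans (le_abs_self _) <| abs_le_of_sq_le_sq ?_ (by positivity)
      rw [mul_pow, mul_pow, Real.sq_sqrt (by positivity), ← Real.exp_nat_mul]
      refine (h.grad_le _).trans ?_
      have e4 := h.excess_le hb hu hτ
      have e5 : ((2 : ℕ) : ℝ) * -(ν * τ) = -(4 * L * α / b ^ 2 * τ) := by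
        rw [hν]; push_cast; ring
      rw [e5]
      have := mul_le_mul_of_nonneg_left e4 (by positivity : 0 ≤ 4 * β)
      rw [hf0]; linarith
    calc _ ≤ b * frobNorm (G (netMatrix (ofArray (u τ)))) := e2
      _ ≤ b * (2 * Real.sqrt (β * f0) * Real.exp (-(ν * τ))) :=
        mul_le_mul_of_nonneg_left e3 hb.le
      _ = _ := by ring
  have hB : ∀ τ, HasDerivAt (fun τ => c * (Real.exp (-(ν * s)) - Real.exp (-(ν * τ))))
      (c * ν * Real.exp (-(ν * τ))) τ := by
    intro τ
    have h1 : HasDerivAt (fun τ => Real.exp (-(ν * τ))) (Real.exp (-(ν * τ)) * (-ν)) τ := by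
      simpa using ((hasDerivAt_id τ).const_mul ν).neg.exp
    exact ((h1.const_sub (Real.exp (-(ν * s)))).const_mul c).congr_deriv (by ring)
  have hfin := image_norm_le_of_norm_deriv_right_le_deriv_boundary' (f := g) (f' := g')
    (a := s) (b := t)
    (fun τ hτ => ((hg τ ⟨hs.trans hτ.1, hτ.2.trans ht⟩).continuousWithinAt).mono
      fun x hx => hs.trans hx.1)
    (fun τ hτ => (hg τ ⟨hs.trans hτ.1, hτ.2.le.trans ht⟩).mono
      (Set.Ici_subset_Ici.2 (hs.trans hτ.1)))
    (B := fun τ => c * (Real.exp (-(ν * s)) - Real.exp (-(ν * τ))))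
    (B' := fun τ => c * ν * Real.exp (-(ν * τ)))
    (by
      have : g s = 0 := by ext q; simp [g]
      simp [this])
    (fun τ _ => (hB τ).continuousAt.continuousWithinAt)
    (fun τ _ => (hB τ).hasDerivWithinAt)
    (fun τ hτ => hg'n τ ⟨hs.trans hτ.1, hτ.2.le.trans ht⟩) ⟨hst, le_rfl⟩
  rw [frobNorm_eq_norm]
  exact hfin

end GradientFlow

/-! ### Convergence from a well-conditioned initialization. -/

section Convergence

variable {L d : ℕ}

lemma abs_le_frobNorm {n m : ℕ} (M : Matrix (Fin m) (Fin n) ℝ) (i : Fin m) (j : Fin n) :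
    |M i j| ≤ frobNorm M := by
  rw [frobNorm_eq_norm]
  exact PiLp.norm_apply_le (WithLp.toLp 2 (fun q : Fin m × Fin n => M q.1 q.2)) (i, j)

/-- Within this radius prefix products have bound 2A, hence suffix products (2A)². A layer gradient
involves one of each, whence (2A)³ = 8A³. -/
lemma wellConditioned_of_near {G : Matrix (Fin d) (Fin d) ℝ → Matrix (Fin d) (Fin d) ℝ}
    {W₀ W : Params L d} {A : ℝ} (hA : 0 < A) (h₀ : ∀ k ≤ L, TwoSided (prefixProd W₀ k) A)
    (h : ∀ k, frobNorm (W k - W₀ k) ≤ 1 / (2 * A ^ 2) / L) :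
    WellConditioned G (8 * A ^ 3) W := by
  have hpre : ∀ k ≤ L, TwoSided (prefixProd W k) (2 * A) := fun k hk =>
    prefixProd_twoSided_of_near hA (by positivity) (by field_simp; norm_num) h₀ h hk
  intro k
  have h1 := hpre k k.2.le
  have h2 := suffixProd_twoSided (by positivity) hpre k.2
  have e : 2 * A * (2 * A) * (2 * A) = 8 * A ^ 3 := by ring
  have h3 := h2.le_frobNorm_conj (by positivity) (by positivity) h1 (G (netMatrix W))
  have h4 := h2.frobNorm_conj_le (by positivity) (by positivity) h1 (G (netMatrix W))
  rw [e] at h3 h4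
  exact ⟨h3, h4⟩

lemma continuous_frobNorm_sub (W₀ : Params L d) (k : Fin L) :
    Continuous fun w : Fin L → Fin d → Fin d → ℝ => frobNorm (ofArray w k - W₀ k) := by
  refine continuous_frobNorm.comp (Continuous.sub ?_ continuous_const)
  exact continuous_apply k

/-- If all prefix products at initialization are well-conditioned and the initial excess risk is
small, the gradient flow is global and converges to a minimizer close to its starting point. -/
theorem IsComparable.gradientFlow_converges {ρ : Matrix (Fin d) (Fin d) ℝ → ℝ}
    {G : Matrix (Fin d) (Fin d) ℝ → Matrix (Fin d) (Fin d) ℝ} {m α β : ℝ}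
    (h : IsComparable ρ G m α β) (hL : 0 < L) {W₀ : Params L d} {A : ℝ} (hA : 0 < A)
    (h₀ : ∀ k ≤ L, TwoSided (prefixProd W₀ k) A)
    (hinit : ρ (netMatrix W₀) - m ≤ (1 / (2048 * A ^ 11)) ^ 2 * α ^ 2 / β) :
    ∃ W', GradientFlowConvergesTo (fun W => ρ (netMatrix W)) W₀ W' ∧ ρ (netMatrix W') = m ∧
      ∀ k, frobNorm (W' k - W₀ k) ≤ 1 / (2 * A ^ 2) / L := by
  have hL' : (0 : ℝ) < L := by exact_mod_cast hL
  have hα := h.alpha_pos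
  have hβ := h.beta_pos
  set b : ℝ := 8 * A ^ 3 with hb
  have hb0 : 0 < b := by positivity
  set η : ℝ := 1 / (2 * A ^ 2) / L with hη
  have hη0 : 0 < η := by positivity
  set f0 := ρ (netMatrix W₀) - m with hf0
  have hf00 : 0 ≤ f0 := sub_nonneg.2 (h.le _)
  set c := b ^ 3 * Real.sqrt (β * f0) / (L * α) with hc
  have hc0 : 0 ≤ c := by positivity
  -- The constant 2048A¹¹ is chosen for this: b³ = 512A⁹ and 512A⁹/(2048A¹¹) = 1/(4A²), which is
  -- half of 1/(2A²).
  have hcη : c ≤ η / 2 := by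
    have h1 : Real.sqrt (β * f0) ≤ 1 / (2048 * A ^ 11) * α := by
      refine Real.sqrt_le_iff.2 ⟨by positivity, ?_⟩
      have := mul_le_mul_of_nonneg_left hinit hβ.le
      refine this.trans (le_of_eq ?_)
      field_simp
    rw [hc, div_le_iff₀ (by positivity)]
    refine (mul_le_mul_of_nonneg_left h1 (by positivity)).trans (le_of_eq ?_)
    rw [hη, hb]; field_simp; norm_num
  set F : (Fin L → Fin d → Fin d → ℝ) → (Fin L → Fin d → Fin d → ℝ) :=
    fun w k i j => -(chainGrad G (ofArray w) k i j) with hF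
  have hFs : ContDiff ℝ 1 F := contDiff_chainGrad h.contDiff_grad
  let w₀ : Fin L → Fin d → Fin d → ℝ := W₀
  have hw₀ : ofArray w₀ = W₀ := rfl
  let S : Set (Fin L → Fin d → Fin d → ℝ) := {w | ∀ k, frobNorm (ofArray w k - W₀ k) ≤ η}
  let U : Set (Fin L → Fin d → Fin d → ℝ) := {w | ∀ k, frobNorm (ofArray w k - W₀ k) < η}
  have hS : IsClosed S := by
    simp only [S, Set.ofPred_forall]
    exact isClosed_iInter fun k => isClosed_le (continuous_frobNorm_sub W₀ k) continuous_const
  have hU : IsOpen U := by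
    simp only [U, Set.ofPred_forall]
    exact isOpen_iInter_of_finite fun k =>
      isOpen_lt (continuous_frobNorm_sub W₀ k) continuous_const
  have hUS : U ⊆ S := fun w hw k => (hw k).le
  have hSb : Bornology.IsBounded S := by
    refine (Metric.isBounded_closedBall (x := w₀) (r := η)).subset fun w hw => ?_
    rw [Metric.mem_closedBall]
    refine (dist_pi_le_iff hη0.le).2 fun k => (dist_pi_le_iff hη0.le).2 fun i =>
      (dist_pi_le_iff hη0.le).2 fun j => ?_
    exact (abs_le_frobNorm (ofArray w k - W₀ k) i j).trans (hw k)
  have hw₀S : w₀ ∈ S := fun k => by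
    have : frobNorm (ofArray w₀ k - W₀ k) = 0 := by rw [hw₀, sub_self]; simp [frobNorm]
    rw [this]; exact hη0.le
  have hwc : ∀ w ∈ S, WellConditioned G b (ofArray w) := fun w hw =>
    wellConditioned_of_near hA h₀ hw
  obtain ⟨⟨u, hu⟩, hmem⟩ := isForwardFlow_of_bootstrap hFs hS hSb hU hUS hw₀S (by
    intro u T hT hu0 hu k
    have h1 := h.frobNorm_sub_le hL hb0 (u := u) (T := T)
      (fun t ht => ⟨hwc _ (hu t ht).1, (hu t ht).2⟩) le_rfl hT le_rfl k
    rw [hu0, hw₀] at h1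
    refine lt_of_le_of_lt h1 (lt_of_le_of_lt (mul_le_of_le_one_right hc0 ?_) (by linarith))
    have := Real.exp_pos (-(2 * L * α / b ^ 2 * T))
    simp only [mul_zero, neg_zero, Real.exp_zero]
    linarith)
  have huS := hmem u hu
  have hu' : ∀ T, ∀ t ∈ Set.Icc 0 T, WellConditioned G b (ofArray (u t)) ∧
      HasDerivWithinAt u (F (u t)) (Set.Ici 0) t := fun T t ht =>
    ⟨hwc _ (huS t ht.1), hu.2 t ht.1⟩
  set ν := 2 * L * α / b ^ 2 with hν
  have hν0 : 0 < ν := by positivity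
  have hlim : Tendsto (fun t : ℝ => c * Real.exp (-(ν * t))) atTop (𝓝 0) := by
    have : Tendsto (fun t : ℝ => Real.exp (-(ν * t))) atTop (𝓝 0) :=
      Real.tendsto_exp_neg_atTop_nhds_zero.comp (tendsto_id.const_mul_atTop hν0)
    simpa using this.const_mul c
  -- Nothing constrains `u` at negative times; replacing `t` by `max t 0` leaves the behaviour at
  -- infinity unchanged.
  have hcauchy : CauchySeq (fun t : ℝ => u (max t 0)) := by
    refine cauchySeq_of_le_tendsto_0' (fun t => c * Real.exp (-(ν * max t 0))) ?_ ?_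
    · intro s t hst
      have hnn : 0 ≤ c * Real.exp (-(ν * max s 0)) := by positivity
      refine (dist_pi_le_iff hnn).2 fun k => (dist_pi_le_iff hnn).2 fun i =>
        (dist_pi_le_iff hnn).2 fun j => ?_
      have h1 := h.frobNorm_sub_le hL hb0 (hu' (max t 0)) (le_max_right s 0)
        (max_le_max_right 0 hst) le_rfl k
      rw [hu.1, hw₀] at h1
      rw [dist_comm]
      refine ((abs_le_frobNorm (ofArray (u (max t 0)) k - ofArray (u (max s 0)) k) i j).trans
        h1).trans (mul_le_mul_of_nonneg_left ?_ hc0)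
      linarith [Real.exp_pos (-(ν * max t 0))]
    · refine hlim.congr' ?_
      filter_upwards [eventually_ge_atTop (0 : ℝ)] with t ht
      rw [max_eq_left ht]
  obtain ⟨w', hw'⟩ := cauchySeq_tendsto_of_complete hcauchy
  have hutend : Tendsto u atTop (𝓝 w') := by
    refine hw'.congr' ?_
    filter_upwards [eventually_ge_atTop (0 : ℝ)] with t ht
    rw [max_eq_left ht]
  have hiff : ∀ v : ℝ → Fin L → Fin d → Fin d → ℝ,
      IsGradientFlow (fun W => ρ (netMatrix W)) W₀ (fun t => ofArray (v t)) ↔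
        IsForwardFlow F w₀ v := fun v => isGradientFlow_iff (w₀ := w₀) h.layerGrad_eq
  refine ⟨ofArray w', ⟨⟨fun t => ofArray (u t), (hiff u).2 hu⟩, ?_⟩, ?_, ?_⟩
  · intro V hV
    have hV' : IsForwardFlow F w₀ (V : ℝ → Fin L → Fin d → Fin d → ℝ) := (hiff V).1 hV
    refine Tendsto.congr' (f₁ := u) ?_ hutend
    filter_upwards [eventually_ge_atTop (0 : ℝ)] with t ht
    exact hu.unique hFs hV' ht
  · have hRc := (contDiff_comp_netMatrix (L := L) h.contDiff).continuous
    have h1 : Tendsto (fun t => ρ (netMatrix (ofArray (u t))) - m) atTop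
        (𝓝 (ρ (netMatrix (ofArray w')) - m)) :=
      ((hRc.tendsto w').comp hutend).sub_const m
    have h2 : Tendsto (fun t => ρ (netMatrix (ofArray (u t))) - m) atTop (𝓝 0) := by
      have hμ0 : 0 < 4 * L * α / b ^ 2 := by positivity
      have h3 : Tendsto (fun t : ℝ => f0 * Real.exp (-(4 * L * α / b ^ 2 * t))) atTop (𝓝 0) := by
        have : Tendsto (fun t : ℝ => Real.exp (-(4 * L * α / b ^ 2 * t))) atTop (𝓝 0) :=
          Real.tendsto_exp_neg_atTop_nhds_zero.comp (tendsto_id.const_mul_atTop hμ0)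
        simpa using this.const_mul f0
      refine squeeze_zero' (Eventually.of_forall fun t => sub_nonneg.2 (h.le _)) ?_ h3
      filter_upwards [eventually_ge_atTop (0 : ℝ)] with t ht
      have := h.excess_le hb0 (hu' t) ⟨ht, le_rfl⟩
      rwa [hu.1, hw₀] at this
    exact sub_eq_zero.1 (tendsto_nhds_unique h1 h2)
  · refine hS.mem_of_tendsto hutend ?_
    filter_upwards [eventually_ge_atTop (0 : ℝ)] with t ht using huS t ht

end Convergence

/-! ### Spectrum of the empirical covariance matrix. -/

section Spectral

variable {n d : ℕ}

lemma covMatrix_isHermitian (X : Matrix (Fin n) (Fin d) ℝ) : (covMatrix X).IsHermitian := by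
  ext i j
  simp [covMatrix, Matrix.mul_apply, mul_comm]

lemma dotProduct_covMatrix_mulVec (X : Matrix (Fin n) (Fin d) ℝ) (u : Fin d → ℝ) :
    u ⬝ᵥ (covMatrix X *ᵥ u) = 1 / n * vnorm (X *ᵥ u) ^ 2 := by
  rw [covMatrix, smul_mulVec, dotProduct_smul, smul_eq_mul, ← mulVec_mulVec, dotProduct_mulVec,
    vecMul_transpose, vnorm_sq_eq_dotProduct]

lemma covMatrix_ne_zero {X : Matrix (Fin n) (Fin d) ℝ} (hX : X ≠ 0) : covMatrix X ≠ 0 := by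
  intro h0
  have hn : (0 : ℝ) < n := by
    rcases Nat.eq_zero_or_pos n with h | h
    · subst h; exact absurd (Matrix.ext fun i => i.elim0) hX
    · exact_mod_cast h
  apply hX
  ext i j
  have h1 := dotProduct_covMatrix_mulVec X (Pi.single j 1)
  rw [h0, zero_mulVec, dotProduct_zero] at h1
  have h2 : vnorm (X *ᵥ Pi.single j 1) = 0 := by
    have : 1 / (n : ℝ) ≠ 0 := by positivity
    exact pow_eq_zero_iff two_ne_zero |>.1 ((mul_eq_zero.1 h1.symm).resolve_left this)
  have := congrFun (vnorm_eq_zero.1 h2) i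
  simpa using this

variable (X : Matrix (Fin n) (Fin d) ℝ)

lemma eigenvalues_covMatrix_nonneg (i : Fin d) :
    0 ≤ (covMatrix_isHermitian X).eigenvalues i := by
  set v : Fin d → ℝ := WithLp.ofLp ((covMatrix_isHermitian X).eigenvectorBasis i) with hv
  have h1 := dotProduct_covMatrix_mulVec X v
  rw [hv, (covMatrix_isHermitian X).mulVec_eigenvectorBasis, dotProduct_smul, ← hv,
    ← vnorm_sq_eq_dotProduct] at h1
  have h2 : vnorm v = 1 := (covMatrix_isHermitian X).eigenvectorBasis.norm_eq_one i
  rw [h2] at h1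
  simp only [one_pow, smul_eq_mul, mul_one] at h1
  rw [h1]; positivity

lemma finite_spectrum_covMatrix : (spectrum ℝ (covMatrix X)).Finite := by
  rw [(covMatrix_isHermitian X).spectrum_real_eq_range_eigenvalues]
  exact Set.finite_range _

lemma eigenvalues_le_largestEig (i : Fin d) :
    (covMatrix_isHermitian X).eigenvalues i ≤ largestEig X :=
  le_csSup (finite_spectrum_covMatrix X).bddAbove
    ((covMatrix_isHermitian X).eigenvalues_mem_spectrum_real i)

lemma smallestNonzeroEig_le {i : Fin d} (h : (covMatrix_isHermitian X).eigenvalues i ≠ 0) :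
    smallestNonzeroEig X ≤ (covMatrix_isHermitian X).eigenvalues i :=
  csInf_le ((finite_spectrum_covMatrix X).subset fun _ hx => hx.1).bddBelow
    ⟨(covMatrix_isHermitian X).eigenvalues_mem_spectrum_real i, h⟩

/-- The `c i` are the coordinates of `u` in an orthonormal eigenbasis. Both gradient bounds thereby
reduce to λμ ≤ μ² ≤ Λμ for each eigenvalue μ; zero eigenvalues contribute nothing to either side. -/
lemma quadForm_eq (u : Fin d → ℝ) : ∃ c : Fin d → ℝ,
    u ⬝ᵥ (covMatrix X *ᵥ u) = ∑ i, (covMatrix_isHermitian X).eigenvalues i * c i ^ 2 ∧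
    vnorm (covMatrix X *ᵥ u) ^ 2 =
      ∑ i, (covMatrix_isHermitian X).eigenvalues i ^ 2 * c i ^ 2 := by
  set hS := covMatrix_isHermitian X
  set b := hS.eigenvectorBasis with hb
  have hinner : ∀ x y : Fin d → ℝ, inner ℝ (WithLp.toLp 2 x) (WithLp.toLp 2 y) = x ⬝ᵥ y := by
    intro x y
    simp [EuclideanSpace.inner_toLp_toLp, dotProduct_comm]
  have hkey : ∀ i, inner ℝ (b i) (WithLp.toLp 2 (covMatrix X *ᵥ u)) =
      hS.eigenvalues i * inner ℝ (b i) (WithLp.toLp 2 u) := by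
    intro i
    have h1 : b i = WithLp.toLp 2 (WithLp.ofLp (b i)) := rfl
    have h2 : (covMatrix X)ᵀ = covMatrix X := hS
    rw [h1, hinner, hinner, dotProduct_mulVec, ← mulVec_transpose, h2,
      hS.mulVec_eigenvectorBasis, smul_dotProduct, smul_eq_mul]
  refine ⟨fun i => inner ℝ (b i) (WithLp.toLp 2 u), ?_, ?_⟩
  · rw [← hinner, ← b.sum_inner_mul_inner]
    refine Finset.sum_congr rfl fun i _ => ?_
    rw [hkey, real_inner_comm]; ring
  · unfold vnorm
    rw [← b.sum_sq_norm_inner_right]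
    refine Finset.sum_congr rfl fun i _ => ?_
    rw [hkey, Real.norm_eq_abs, sq_abs, mul_pow]

lemma smallestNonzeroEig_mul_le (u : Fin d → ℝ) :
    smallestNonzeroEig X * (u ⬝ᵥ (covMatrix X *ᵥ u)) ≤ vnorm (covMatrix X *ᵥ u) ^ 2 := by
  obtain ⟨c, h1, h2⟩ := quadForm_eq X u
  rw [h1, h2, Finset.mul_sum]
  refine Finset.sum_le_sum fun i _ => ?_
  rw [← mul_assoc]
  refine mul_le_mul_of_nonneg_right ?_ (sq_nonneg _)
  by_cases h : (covMatrix_isHermitian X).eigenvalues i = 0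
  · simp [h]
  · nlinarith [smallestNonzeroEig_le X h, eigenvalues_covMatrix_nonneg X i]

lemma le_largestEig_mul (u : Fin d → ℝ) :
    vnorm (covMatrix X *ᵥ u) ^ 2 ≤ largestEig X * (u ⬝ᵥ (covMatrix X *ᵥ u)) := by
  obtain ⟨c, h1, h2⟩ := quadForm_eq X u
  rw [h1, h2, Finset.mul_sum]
  refine Finset.sum_le_sum fun i _ => ?_
  rw [← mul_assoc]
  refine mul_le_mul_of_nonneg_right ?_ (sq_nonneg _)
  nlinarith [eigenvalues_le_largestEig X i, eigenvalues_covMatrix_nonneg X i]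

variable {X}

/-- Some eigenvalue is nonzero because the covariance matrix is. The infimum over the finite
nonempty set of nonzero eigenvalues is attained, so it is nonzero as well as nonnegative. -/
lemma smallestNonzeroEig_pos (hX : X ≠ 0) : 0 < smallestNonzeroEig X ∧ 0 < largestEig X := by
  have hex : ∃ i, (covMatrix_isHermitian X).eigenvalues i ≠ 0 := by
    by_contra hc
    push Not at hc
    refine covMatrix_ne_zero hX ?_
    ext i j
    obtain ⟨c, -, h2⟩ := quadForm_eq X (Pi.single j 1)
    simp only [hc] at h2
    have h3 : vnorm (covMatrix X *ᵥ Pi.single j 1) = 0 := by simpa using h2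
    have := congrFun (vnorm_eq_zero.1 h3) i
    simpa using this
  obtain ⟨i, hi⟩ := hex
  have hpos := (eigenvalues_covMatrix_nonneg X i).lt_of_ne' hi
  refine ⟨?_, hpos.trans_le (eigenvalues_le_largestEig X i)⟩
  have hmem : smallestNonzeroEig X ∈ {μ : ℝ | μ ∈ spectrum ℝ (covMatrix X) ∧ μ ≠ 0} :=
    Set.Nonempty.csInf_mem ⟨_, (covMatrix_isHermitian X).eigenvalues_mem_spectrum_real i, hi⟩
      ((finite_spectrum_covMatrix X).subset fun _ hx => hx.1)
  obtain ⟨h1, h2⟩ := hmem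
  rw [(covMatrix_isHermitian X).spectrum_real_eq_range_eigenvalues] at h1
  obtain ⟨k, hk⟩ := h1
  refine lt_of_le_of_ne ?_ h2.symm
  rw [← hk]; exact eigenvalues_covMatrix_nonneg X k

end Spectral

/-! ### Regression risks and their gradient inequalities. -/

section Regression

variable {n d : ℕ}

/-- The gradient of `linRisk`. -/
noncomputable def riskGrad (X : Matrix (Fin n) (Fin d) ℝ) (y : Fin n → ℝ) (w : Fin d → ℝ) :
    Fin d → ℝ :=
  (2 / n : ℝ) • (Xᵀ *ᵥ (X *ᵥ w - y))

variable (X : Matrix (Fin n) (Fin d) ℝ) (y : Fin n → ℝ)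

lemma linRisk_eq (w : Fin d → ℝ) :
    linRisk X y w = 1 / n * ((y - X *ᵥ w) ⬝ᵥ (y - X *ᵥ w)) := by
  rw [← vnorm_sq_eq_dotProduct]; rfl

lemma linRisk_add_smul (w v : Fin d → ℝ) (t : ℝ) :
    linRisk X y (w + t • v) =
      linRisk X y w + t * (riskGrad X y w ⬝ᵥ v) + t ^ 2 * (v ⬝ᵥ (covMatrix X *ᵥ v)) := by
  have h1 : riskGrad X y w ⬝ᵥ v = 2 / n * ((X *ᵥ w - y) ⬝ᵥ (X *ᵥ v)) := by
    rw [riskGrad, smul_dotProduct, smul_eq_mul, dotProduct_mulVec, ← mulVec_transpose]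
  rw [linRisk_eq, linRisk_eq, h1, dotProduct_covMatrix_mulVec, vnorm_sq_eq_dotProduct, mulVec_add,
    mulVec_smul]
  simp only [dotProduct_add, add_dotProduct, dotProduct_sub, sub_dotProduct, dotProduct_smul,
    smul_dotProduct, smul_eq_mul]
  rw [dotProduct_comm (X *ᵥ w) y, dotProduct_comm (X *ᵥ v) y, dotProduct_comm (X *ᵥ v) (X *ᵥ w)]
  ring

/-- Solvability of the normal equations: XᵀX and Xᵀ have nested ranges of the same rank, hence the
same range. -/
lemma exists_normal_eq : ∃ w, riskGrad X y w = 0 := by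
  have hr : LinearMap.range (Xᵀ * X).mulVecLin = LinearMap.range Xᵀ.mulVecLin := by
    refine Submodule.eq_of_le_of_finrank_eq ?_ ?_
    · rw [mulVecLin_mul]; exact LinearMap.range_comp_le_range _ _
    · have h1 := rank_transpose_mul_self X
      have h2 := rank_transpose X
      rw [← h2] at h1
      exact h1
  have hmem : Xᵀ *ᵥ y ∈ LinearMap.range (Xᵀ * X).mulVecLin := by
    rw [hr]; exact ⟨y, rfl⟩
  obtain ⟨w, hw⟩ := hmem
  refine ⟨w, ?_⟩
  rw [mulVecLin_apply, ← mulVec_mulVec] at hw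
  rw [riskGrad, mulVec_sub, hw, sub_self, smul_zero]

lemma riskGrad_add (w v : Fin d → ℝ) :
    riskGrad X y (w + v) = riskGrad X y w + (2 : ℝ) • (covMatrix X *ᵥ v) := by
  simp only [riskGrad, covMatrix, mulVec_add, mulVec_sub, smul_mulVec, ← mulVec_mulVec, smul_add,
    smul_sub, smul_smul]
  rw [show (2 : ℝ) * (1 / n) = 2 / n by ring]
  abel

/-- The excess risk is the quadratic form of the covariance matrix at the error, and the gradient
is twice the image of the error. -/
lemma exists_minimizer : ∃ w₀, minRisk X y = linRisk X y w₀ ∧ ∀ w,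
    linRisk X y w - minRisk X y = (w - w₀) ⬝ᵥ (covMatrix X *ᵥ (w - w₀)) ∧
    riskGrad X y w = (2 : ℝ) • (covMatrix X *ᵥ (w - w₀)) := by
  obtain ⟨w₀, hw₀⟩ := exists_normal_eq X y
  have h1 : ∀ w, linRisk X y w = linRisk X y w₀ + (w - w₀) ⬝ᵥ (covMatrix X *ᵥ (w - w₀)) := by
    intro w
    have := linRisk_add_smul X y w₀ (w - w₀) 1
    rw [one_smul, add_sub_cancel, hw₀, zero_dotProduct] at this
    linarith
  have h2 : ∀ w, linRisk X y w₀ ≤ linRisk X y w := by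
    intro w
    rw [h1 w, dotProduct_covMatrix_mulVec]
    have : 0 ≤ 1 / (n : ℝ) * vnorm (X *ᵥ (w - w₀)) ^ 2 := by positivity
    linarith
  have hmin : minRisk X y = linRisk X y w₀ :=
    le_antisymm (ciInf_le ⟨_, by rintro _ ⟨w, rfl⟩; exact h2 w⟩ w₀) (le_ciInf h2)
  refine ⟨w₀, hmin, fun w => ⟨by rw [hmin, h1 w]; ring, ?_⟩⟩
  have := riskGrad_add X y w₀ (w - w₀)
  rwa [add_sub_cancel, hw₀, zero_add] at this

/-- With v the distance vector to a minimizer, the excess is ⟨v, Σ̂v⟩ and the gradient is 2Σ̂v; the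
4 is the square of this 2. -/
lemma riskGrad_bounds (w : Fin d → ℝ) :
    4 * smallestNonzeroEig X * (linRisk X y w - minRisk X y) ≤ vnorm (riskGrad X y w) ^ 2 ∧
    vnorm (riskGrad X y w) ^ 2 ≤ 4 * largestEig X * (linRisk X y w - minRisk X y) := by
  obtain ⟨w₀, -, h⟩ := exists_minimizer X y
  obtain ⟨h1, h2⟩ := h w
  rw [h1, h2, vnorm_smul, mul_pow, sq_abs]
  have := smallestNonzeroEig_mul_le X (w - w₀)
  have := le_largestEig_mul X (w - w₀)
  constructor <;> linarith

lemma contDiff_linRisk : ContDiff ℝ 1 (linRisk X y) := by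
  have : linRisk X y = fun w => 1 / n * ∑ i, (y i - ∑ j, X i j * w j) * (y i - ∑ j, X i j * w j) := by
    ext w
    rw [linRisk_eq]
    simp [dotProduct, mulVec]
  rw [this]
  fun_prop

lemma contDiff_riskGrad : ContDiff ℝ 1 (riskGrad X y) := by
  have : riskGrad X y = fun w k => 2 / n * ∑ i, X i k * (∑ j, X i j * w j - y i) := by
    ext w k
    simp [riskGrad, mulVec, dotProduct]
  rw [this]
  fun_prop

variable {X}

/-- Univariate regression through a nonzero output vector. -/
lemma isComparable_linRisk (hX : X ≠ 0) {p : Fin d → ℝ} (hp : p ≠ 0) :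
    IsComparable (fun M => linRisk X y (Mᵀ *ᵥ p))
      (fun M => vecMulVec p (riskGrad X y (Mᵀ *ᵥ p))) (minRisk X y)
      (smallestNonzeroEig X * vnorm p ^ 2) (largestEig X * vnorm p ^ 2) := by
  have hp' := vnorm_pos hp
  obtain ⟨hl, hu⟩ := smallestNonzeroEig_pos hX
  have hfrob : ∀ r : Fin d → ℝ, frobNorm (vecMulVec p r) ^ 2 = vnorm p ^ 2 * vnorm r ^ 2 := by
    intro r
    rw [frobNorm_sq, vnorm_sq, vnorm_sq, Finset.sum_mul_sum]
    simp [vecMulVec_apply, mul_pow]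
  have hlin : ContDiff ℝ 1 (fun M : Fin d → Fin d → ℝ => (Matrix.of M)ᵀ *ᵥ p) := by
    refine contDiff_pi.2 fun i => ?_
    simp only [mulVec, dotProduct, transpose_apply, of_apply]
    fun_prop
  refine ⟨⟨fun D => (Dᵀ *ᵥ p) ⬝ᵥ (covMatrix X *ᵥ (Dᵀ *ᵥ p)), fun M D t => ?_⟩,
    (contDiff_linRisk X y).comp hlin, fun i j => ?_, by positivity, by positivity,
    fun M => ?_, fun M => ?_⟩
  · rw [transpose_add, transpose_smul, add_mulVec, smul_mulVec, linRisk_add_smul]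
    congr 3
    simp only [dotProduct, mulVec, transpose_apply, vecMulVec_apply, Finset.mul_sum]
    rw [Finset.sum_comm]
    refine Finset.sum_congr rfl fun i _ => Finset.sum_congr rfl fun j _ => ?_
    ring
  · simp only [vecMulVec_apply]
    exact contDiff_const.mul (contDiff_pi.1 ((contDiff_riskGrad X y).comp hlin) j)
  · rw [hfrob]
    have := mul_le_mul_of_nonneg_left (riskGrad_bounds X y (Mᵀ *ᵥ p)).1 (sq_nonneg (vnorm p))
    linarith
  · rw [hfrob]
    have := mul_le_mul_of_nonneg_left (riskGrad_bounds X y (Mᵀ *ᵥ p)).2 (sq_nonneg (vnorm p))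
    linarith

/-- Covers a zero output vector `p`, for which the risk does not depend on the weights. -/
lemma isComparable_const (c : ℝ) :
    IsComparable (fun _ : Matrix (Fin d) (Fin d) ℝ => c) (fun _ => 0) c 1 1 := by
  refine ⟨⟨fun _ => 0, fun _ _ _ => by simp⟩, contDiff_const, fun _ _ => contDiff_const,
    one_pos, one_pos, fun _ => ?_, fun _ => ?_⟩ <;> simp [frobNorm]

variable (Y : Matrix (Fin n) (Fin d) ℝ)

/-- The rows of `M` solve independent univariate regressions onto the columns of `Y`, so the
multivariate inequalities follow by summation. -/
lemma linRiskMulti_eq_sum (M : Matrix (Fin d) (Fin d) ℝ) :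
    linRiskMulti X Y M = ∑ j, linRisk X (fun i => Y i j) (M j) := by
  rw [linRiskMulti, frobNorm_sq_col, Finset.mul_sum]
  rfl

lemma minRiskMulti_eq_sum : minRiskMulti X Y = ∑ j, minRisk X (fun i => Y i j) := by
  choose w₀ h₀ h using fun j => exists_minimizer X (fun i => Y i j)
  have hle : ∀ j w, minRisk X (fun i => Y i j) ≤ linRisk X (fun i => Y i j) w := fun j w => by
    have h1 := (h j w).1
    rw [dotProduct_covMatrix_mulVec] at h1
    have : 0 ≤ 1 / (n : ℝ) * vnorm (X *ᵥ (w - w₀ j)) ^ 2 := by positivity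
    linarith
  have h2 : ∀ M, ∑ j, minRisk X (fun i => Y i j) ≤ linRiskMulti X Y M := fun M => by
    rw [linRiskMulti_eq_sum]
    exact Finset.sum_le_sum fun j _ => hle j _
  refine le_antisymm ((ciInf_le ⟨_, by rintro _ ⟨M, rfl⟩; exact h2 M⟩ (Matrix.of w₀)).trans ?_)
    (le_ciInf h2)
  rw [linRiskMulti_eq_sum]
  exact Finset.sum_le_sum fun j _ => (h₀ j).ge

/-- Multivariate regression. -/
lemma isComparable_linRiskMulti (hX : X ≠ 0) :
    IsComparable (linRiskMulti X Y)
      (fun M => Matrix.of fun j => riskGrad X (fun i => Y i j) (M j)) (minRiskMulti X Y)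
      (smallestNonzeroEig X) (largestEig X) := by
  obtain ⟨hl, hu⟩ := smallestNonzeroEig_pos hX
  have hfrob : ∀ M : Matrix (Fin d) (Fin d) ℝ, frobNorm (Matrix.of fun j =>
      riskGrad X (fun i => Y i j) (M j)) ^ 2 =
      ∑ j, vnorm (riskGrad X (fun i => Y i j) (M j)) ^ 2 := by
    intro M
    rw [frobNorm_sq]
    simp [vnorm_sq]
  have hrow : ∀ j, ContDiff ℝ 1 (fun M : Fin d → Fin d → ℝ => M j) := fun j =>
    contDiff_apply ℝ (Fin d → ℝ) j
  refine ⟨⟨fun D => ∑ j, D j ⬝ᵥ (covMatrix X *ᵥ D j), fun M D t => ?_⟩,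
    ?_, fun i j => ?_, hl, hu, fun M => ?_, fun M => ?_⟩
  · simp only [linRiskMulti_eq_sum, Finset.mul_sum, ← Finset.sum_add_distrib]
    refine Finset.sum_congr rfl fun j _ => ?_
    have := linRisk_add_smul X (fun i => Y i j) (M j) (D j) t
    rw [← Finset.mul_sum]
    exact this
  · simp only [linRiskMulti_eq_sum]
    exact ContDiff.sum fun j _ => (contDiff_linRisk X _).comp (hrow j)
  · exact contDiff_pi.1 ((contDiff_riskGrad X (fun k => Y k i)).comp (hrow i)) j
  · rw [hfrob, minRiskMulti_eq_sum, linRiskMulti_eq_sum, ← Finset.sum_sub_distrib, Finset.mul_sum]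
    exact Finset.sum_le_sum fun j _ => (riskGrad_bounds X _ _).1
  · rw [hfrob, minRiskMulti_eq_sum, linRiskMulti_eq_sum, ← Finset.sum_sub_distrib, Finset.mul_sum]
    exact Finset.sum_le_sum fun j _ => (riskGrad_bounds X _ _).2

end Regression

/-! ### Moments of the norm through one Gaussian layer. -/

section Gaussian

/-- The Laplace transform of a quadratic polynomial of a standard Gaussian. -/
lemma lintegral_exp_quadratic_le (a : ℝ) {b : ℝ} (hb0 : 0 ≤ b) (hb : b ≤ 1 / 4) :
    ∫⁻ x, ENNReal.ofReal (Real.exp (a * x + b * x ^ 2)) ∂(gaussianReal 0 1) ≤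
      ENNReal.ofReal (Real.exp (2 * b + a ^ 2)) := by
  have hpos : 0 < 1 - 2 * b := by linarith
  -- Completing the square turns the integrand into `K` times the Gaussian density of mean `a * v`
  -- and variance `v`. The condition b ≤ 1/4 gives v ≤ 2 and v ≤ 1 + 4b.
  set v : NNReal := ⟨1 / (1 - 2 * b), by positivity⟩ with hv
  have hvr : (v : ℝ) = 1 / (1 - 2 * b) := rfl
  have hv0 : v ≠ 0 := by
    rw [ne_eq, ← NNReal.coe_eq_zero, hvr]; positivity
  have hvpos : (0 : ℝ) < v := by rw [hvr]; positivity
  set K : ℝ := Real.sqrt v * Real.exp (a ^ 2 * v / 2) with hK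
  have hpt : ∀ x, gaussianPDFReal 0 1 x * Real.exp (a * x + b * x ^ 2) =
      K * gaussianPDFReal (a * v) v x := by
    intro x
    have hs : Real.sqrt (2 * Real.pi * v) = Real.sqrt (2 * Real.pi) * Real.sqrt v :=
      Real.sqrt_mul (by positivity) _
    have hsv : Real.sqrt v ≠ 0 := (Real.sqrt_pos.2 hvpos).ne'
    have hsp : Real.sqrt (2 * Real.pi) ≠ 0 := (Real.sqrt_pos.2 (by positivity)).ne'
    simp only [gaussianPDFReal, NNReal.coe_one, mul_one, sub_zero, hK, hs]
    have he : Real.exp (-x ^ 2 / 2) * Real.exp (a * x + b * x ^ 2) =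
        Real.exp (a ^ 2 * v / 2) * Real.exp (-(x - a * v) ^ 2 / (2 * v)) := by
      rw [← Real.exp_add, ← Real.exp_add]
      congr 1
      rw [hvr]; field_simp; ring
    rw [mul_assoc, he]
    field_simp
  rw [gaussianReal_of_var_ne_zero 0 one_ne_zero,
    lintegral_withDensity_eq_lintegral_mul _ (measurable_gaussianPDF 0 1) (by fun_prop)]
  have h1 : ∀ x, (gaussianPDF 0 1 * fun x => ENNReal.ofReal (Real.exp (a * x + b * x ^ 2))) x =
      ENNReal.ofReal K * gaussianPDF (a * v) v x := by
    intro x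
    rw [Pi.mul_apply, gaussianPDF, gaussianPDF, ← ENNReal.ofReal_mul (gaussianPDFReal_nonneg _ _ _),
      hpt, ENNReal.ofReal_mul (by positivity)]
  simp_rw [h1]
  rw [lintegral_const_mul _ (measurable_gaussianPDF _ _), lintegral_gaussianPDF_eq_one _ hv0, mul_one]
  refine ENNReal.ofReal_le_ofReal ?_
  have hv2 : (v : ℝ) ≤ 2 := by
    rw [hvr, div_le_iff₀ hpos]; linarith
  have h3 : Real.sqrt v ≤ Real.exp (2 * b) := by
    refine Real.sqrt_le_iff.2 ⟨(Real.exp_pos _).le, ?_⟩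
    rw [← Real.exp_nat_mul]
    refine le_trans ?_ (Real.add_one_le_exp _)
    rw [hvr, div_le_iff₀ hpos]
    push_cast
    nlinarith
  rw [hK, Real.exp_add]
  refine mul_le_mul h3 (Real.exp_le_exp.2 ?_) (Real.exp_pos _).le (Real.exp_pos _).le
  nlinarith [sq_nonneg a]

variable {d : ℕ}

/-- The standard Gaussian measure on coordinate vectors. -/
noncomputable abbrev gaussVec (d : ℕ) : Measure (Fin d → ℝ) :=
  Measure.pi fun _ => gaussianReal 0 1

/-- The law of a square matrix with i.i.d. standard Gaussian entries. -/
noncomputable abbrev gaussMat (d : ℕ) : Measure (Fin d → Fin d → ℝ) :=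
  Measure.pi fun _ => gaussVec d

/-- The characteristic function factors over the coordinates, and the exponents add up to that of a
standard Gaussian because `u` has unit norm. -/
lemma map_dotProduct_gaussVec {u : Fin d → ℝ} (hu : vnorm u = 1) :
    (gaussVec d).map (fun x => x ⬝ᵥ u) = gaussianReal 0 1 := by
  have hm : Measurable (fun x : Fin d → ℝ => x ⬝ᵥ u) := by
    unfold dotProduct; fun_prop
  have : IsProbabilityMeasure ((gaussVec d).map (fun x => x ⬝ᵥ u)) :=
    Measure.isProbabilityMeasure_map hm.aemeasurable
  refine Measure.ext_of_charFun ?_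
  ext t
  rw [charFun_apply_real, integral_map hm.aemeasurable (by fun_prop)]
  have h1 : ∀ x : Fin d → ℝ, Complex.exp (t * ((x ⬝ᵥ u : ℝ) : ℂ) * Complex.I) =
      ∏ i, Complex.exp (((t * u i : ℝ) : ℂ) * (x i : ℂ) * Complex.I) := by
    intro x
    rw [← Complex.exp_sum]
    congr 1
    simp only [dotProduct, Complex.ofReal_sum, Complex.ofReal_mul, Finset.mul_sum, Finset.sum_mul]
    refine Finset.sum_congr rfl fun i _ => ?_
    ring
  simp_rw [h1]
  rw [integral_fintype_prod_eq_prod (f := fun i (x : ℝ) =>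
    Complex.exp (((t * u i : ℝ) : ℂ) * (x : ℂ) * Complex.I))]
  simp_rw [← charFun_apply_real, charFun_gaussianReal]
  rw [← Complex.exp_sum]
  congr 1
  have h2 : ∑ i, (u i : ℂ) ^ 2 = 1 := by
    have := vnorm_sq u
    rw [hu, one_pow] at this
    exact_mod_cast this.symm
  simp only [Complex.ofReal_zero, mul_zero, zero_mul, zero_sub, NNReal.coe_one, Complex.ofReal_one,
    one_mul, Complex.ofReal_mul, Finset.sum_neg_distrib, ← Finset.sum_div, mul_pow, ← Finset.mul_sum,
    h2, mul_one]

lemma map_mulVec_gaussMat {u : Fin d → ℝ} (hu : vnorm u = 1) :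
    (gaussMat d).map (fun N => Matrix.of N *ᵥ u) = gaussVec d := by
  have hm : Measurable (fun x : Fin d → ℝ => x ⬝ᵥ u) := by
    unfold dotProduct; fun_prop
  have h := Measure.pi_map_pi (μ := fun _ : Fin d => gaussVec d)
    (f := fun _ x => x ⬝ᵥ u) (fun _ => hm.aemeasurable)
  simp only [map_dotProduct_gaussVec hu] at h
  exact h

lemma measurable_mulVec (u : Fin d → ℝ) :
    Measurable fun N : Fin d → Fin d → ℝ => Matrix.of N *ᵥ u := by
  refine measurable_pi_lambda _ fun i => ?_
  simp only [mulVec, dotProduct, of_apply]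
  fun_prop

lemma lintegral_prod_gaussVec (f : Fin d → ℝ → ENNReal) (hf : ∀ i, Measurable (f i)) :
    ∫⁻ z, ∏ i, f i (z i) ∂(gaussVec d) = ∏ i, ∫⁻ x, f i x ∂(gaussianReal 0 1) := by
  have h := lintegral_prod_eq_prod_lintegral_of_indepFun (μ := gaussVec d) Finset.univ
    (fun i z => f i (z i)) (iIndepFun_pi fun i => (hf i).aemeasurable)
    (fun i => (hf i).comp (measurable_pi_apply i))
  rw [h]
  refine Finset.prod_congr rfl fun i _ => ?_
  exact (measurePreserving_eval (fun _ : Fin d => gaussianReal 0 1) i).lintegral_comp (hf i)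

lemma measurable_vnorm : Measurable (vnorm : (Fin d → ℝ) → ℝ) := by
  have : (vnorm : (Fin d → ℝ) → ℝ) = fun v => Real.sqrt (∑ i, v i ^ 2) := by
    ext v
    rw [← vnorm_sq, Real.sqrt_sq (vnorm_nonneg v)]
  rw [this]
  fun_prop

/-- One residual Gaussian layer. -/
def layer (ε : ℝ) (N : Fin d → Fin d → ℝ) : Matrix (Fin d) (Fin d) ℝ := 1 + ε • Matrix.of N

lemma layer_mulVec (ε : ℝ) (N : Fin d → Fin d → ℝ) {v : Fin d → ℝ} (hv : v ≠ 0) :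
    layer ε N *ᵥ v = vnorm v • ((vnorm v)⁻¹ • v + ε • (Matrix.of N *ᵥ ((vnorm v)⁻¹ • v))) := by
  have := (vnorm_pos hv).ne'
  rw [layer, add_mulVec, one_mulVec, smul_mulVec, mulVec_smul, smul_add, smul_smul, smul_smul,
    smul_smul, mul_inv_cancel₀ this, one_smul]
  congr 2
  field_simp

lemma vnorm_normalize {v : Fin d → ℝ} (hv : v ≠ 0) : vnorm ((vnorm v)⁻¹ • v) = 1 := by
  rw [vnorm_smul, abs_of_nonneg (inv_nonneg.2 (vnorm_nonneg v)), inv_mul_cancel₀ (vnorm_pos hv).ne']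

/-- Growth of the even moments of the norm through one layer. -/
lemma lintegral_vnorm_pow_layer_le {ε : ℝ} {m : ℕ} (hm : m * ε ^ 2 ≤ 1 / 4) (v : Fin d → ℝ) :
    ∫⁻ N, ENNReal.ofReal (vnorm (layer ε N *ᵥ v) ^ (2 * m)) ∂(gaussMat d) ≤
      ENNReal.ofReal (Real.exp (2 * d * (m * ε ^ 2) + 4 * m ^ 2 * ε ^ 2)) *
        ENNReal.ofReal (vnorm v ^ (2 * m)) := by
  rcases eq_or_ne v 0 with rfl | hv
  · have : ∫⁻ _ : Fin d → Fin d → ℝ, ENNReal.ofReal (vnorm (0 : Fin d → ℝ) ^ (2 * m)) ∂(gaussMat d) =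
        ENNReal.ofReal (vnorm (0 : Fin d → ℝ) ^ (2 * m)) := by simp
    simp only [mulVec_zero]
    rw [this]
    refine le_mul_of_one_le_left zero_le ?_
    rw [← ENNReal.ofReal_one]
    exact ENNReal.ofReal_le_ofReal (Real.one_le_exp (by positivity))
  obtain ⟨u, hu⟩ : ∃ u, u = (vnorm v)⁻¹ • v := ⟨_, rfl⟩
  have hu1 : vnorm u = 1 := hu ▸ vnorm_normalize hv
  have hpt : ∀ z : Fin d → ℝ, ENNReal.ofReal (vnorm (vnorm v • (u + ε • z)) ^ (2 * m)) ≤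
      ENNReal.ofReal (vnorm v ^ (2 * m)) *
        ∏ i, ENNReal.ofReal (Real.exp (2 * m * ε * u i * z i + m * ε ^ 2 * z i ^ 2)) := by
    intro z
    rw [← ENNReal.ofReal_prod_of_nonneg (fun i _ => (Real.exp_pos _).le),
      ← ENNReal.ofReal_mul (pow_nonneg (vnorm_nonneg _) _)]
    refine ENNReal.ofReal_le_ofReal ?_
    rw [vnorm_smul, abs_of_nonneg (vnorm_nonneg v), mul_pow]
    refine mul_le_mul_of_nonneg_left ?_ (pow_nonneg (vnorm_nonneg _) _)
    rw [pow_mul, ← Real.exp_sum]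
    -- Using 1 + x ≤ exp x makes the moment factor over the independent coordinates of `z`.
    have h1 : vnorm (u + ε • z) ^ 2 ≤ Real.exp (∑ i, (2 * ε * u i * z i + ε ^ 2 * z i ^ 2)) := by
      refine le_trans (le_of_eq ?_) (Real.add_one_le_exp _)
      have h0 : (1 : ℝ) = ∑ i, u i ^ 2 := by rw [← vnorm_sq, hu1, one_pow]
      rw [h0, vnorm_sq, ← Finset.sum_add_distrib]
      refine Finset.sum_congr rfl fun i _ => ?_
      simp only [Pi.add_apply, Pi.smul_apply, smul_eq_mul]; ring
    refine (pow_le_pow_left₀ (by positivity) h1 m).trans (le_of_eq ?_)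
    rw [← Real.exp_nat_mul, Finset.mul_sum]
    congr 1
    refine Finset.sum_congr rfl fun i _ => ?_
    ring
  have hmeas : ∀ i, Measurable fun x : ℝ =>
      ENNReal.ofReal (Real.exp (2 * m * ε * u i * x + m * ε ^ 2 * x ^ 2)) := fun i => by fun_prop
  calc ∫⁻ N, ENNReal.ofReal (vnorm (layer ε N *ᵥ v) ^ (2 * m)) ∂(gaussMat d)
      = ∫⁻ N, ENNReal.ofReal (vnorm (vnorm v • (u + ε • (Matrix.of N *ᵥ u))) ^ (2 * m))
          ∂(gaussMat d) := by simp_rw [layer_mulVec ε _ hv, ← hu]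
    _ ≤ ∫⁻ N, ENNReal.ofReal (vnorm v ^ (2 * m)) * ∏ i, ENNReal.ofReal (Real.exp
          (2 * m * ε * u i * (Matrix.of N *ᵥ u) i + m * ε ^ 2 * (Matrix.of N *ᵥ u) i ^ 2))
          ∂(gaussMat d) := lintegral_mono fun N => hpt _
    _ = ENNReal.ofReal (vnorm v ^ (2 * m)) * ∫⁻ z, ∏ i, ENNReal.ofReal (Real.exp
          (2 * m * ε * u i * z i + m * ε ^ 2 * z i ^ 2)) ∂(gaussVec d) := by
        rw [lintegral_const_mul' _ _ ENNReal.ofReal_ne_top]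
        conv_rhs => rw [← map_mulVec_gaussMat hu1]
        rw [lintegral_map (by fun_prop) (measurable_mulVec u)]
    _ ≤ ENNReal.ofReal (vnorm v ^ (2 * m)) * ENNReal.ofReal
          (Real.exp (2 * d * (m * ε ^ 2) + 4 * m ^ 2 * ε ^ 2)) := by
        gcongr
        rw [lintegral_prod_gaussVec _ hmeas]
        refine (Finset.prod_le_prod' fun i _ => lintegral_exp_quadratic_le (2 * m * ε * u i)
          (by positivity) hm).trans (le_of_eq ?_)
        rw [← ENNReal.ofReal_prod_of_nonneg (fun i _ => (Real.exp_pos _).le), ← Real.exp_sum,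
          Finset.sum_add_distrib]
        congr 3
        · simp; ring
        · simp_rw [mul_pow _ (u _)]
          rw [← Finset.mul_sum, ← vnorm_sq, hu1]; ring
    _ = _ := mul_comm _ _

/-- Turns negative powers of 1 + x into exponentials of a quadratic, which a Gaussian can integrate.
Staying away from x = -1 is the reason for discarding degenerate layers. -/
lemma exp_sub_sq_le {x : ℝ} (hx : |x| ≤ 1 / 2) : Real.exp (x - x ^ 2) ≤ 1 + x := by
  obtain ⟨h1, h2⟩ := abs_le.1 hx
  have hpos : 0 < Real.exp (-(x - x ^ 2)) := Real.exp_pos _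
  have key : 1 ≤ (1 + x) * Real.exp (-(x - x ^ 2)) := by
    rcases le_total 0 x with h | h
    · have := Real.add_one_le_exp (-(x - x ^ 2))
      nlinarith [pow_nonneg h 3]
    · have := Real.quadratic_le_exp_of_nonneg (x := -(x - x ^ 2)) (by nlinarith)
      have h4 : 1 ≤ (1 + x) * (1 + -(x - x ^ 2) + (-(x - x ^ 2)) ^ 2 / 2) := by
        have h5 : (1 + x) * (1 + -(x - x ^ 2) + (-(x - x ^ 2)) ^ 2 / 2) - 1 =
            x ^ 2 * (x + (1 + x) * (1 - x) ^ 2 / 2) := by ring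
        have h6 : 0 ≤ x + (1 + x) * (1 - x) ^ 2 / 2 := by nlinarith [sq_nonneg x, sq_nonneg (x + 1/2)]
        nlinarith [mul_nonneg (sq_nonneg x) h6]
      nlinarith
  have : Real.exp (x - x ^ 2) * Real.exp (-(x - x ^ 2)) = 1 := by
    rw [← Real.exp_add]; simp
  nlinarith

lemma measurableSet_small_layer (ε : ℝ) (u : Fin d → ℝ) :
    MeasurableSet {N : Fin d → Fin d → ℝ | |ε * ((Matrix.of N *ᵥ u) ⬝ᵥ u)| ≤ 1 / 2} := by
  refine measurableSet_le ?_ measurable_const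
  have h1 : Measurable (fun x : Fin d → ℝ => |ε * (x ⬝ᵥ u)|) := by
    unfold dotProduct
    fun_prop
  exact h1.comp (measurable_mulVec u)

lemma map_quadForm_gaussMat {u : Fin d → ℝ} (hu : vnorm u = 1) :
    (gaussMat d).map (fun N => (Matrix.of N *ᵥ u) ⬝ᵥ u) = gaussianReal 0 1 := by
  have hm : Measurable (fun x : Fin d → ℝ => x ⬝ᵥ u) := by
    unfold dotProduct; fun_prop
  rw [← map_dotProduct_gaussVec hu, ← map_mulVec_gaussMat hu, Measure.map_map hm (measurable_mulVec u)]
  rfl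

/-- Growth of the negative moments of the norm through one layer, away from degenerate layers. -/
lemma setLIntegral_inv_vnorm_pow_layer_le {ε : ℝ} {m : ℕ} (hm : 2 * m * ε ^ 2 ≤ 1 / 4)
    {v : Fin d → ℝ} (hv : v ≠ 0) :
    ∫⁻ N in {N : Fin d → Fin d → ℝ |
        |ε * ((Matrix.of N *ᵥ ((vnorm v)⁻¹ • v)) ⬝ᵥ ((vnorm v)⁻¹ • v))| ≤ 1 / 2},
        (ENNReal.ofReal (vnorm (layer ε N *ᵥ v) ^ (2 * m)))⁻¹ ∂(gaussMat d) ≤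
      ENNReal.ofReal (Real.exp (4 * m * ε ^ 2 + 4 * m ^ 2 * ε ^ 2)) *
        (ENNReal.ofReal (vnorm v ^ (2 * m)))⁻¹ := by
  have hvp := vnorm_pos hv
  have hvm : 0 < vnorm v ^ (2 * m) := pow_pos hvp _
  obtain ⟨u, hu⟩ : ∃ u, u = (vnorm v)⁻¹ • v := ⟨_, rfl⟩
  have hu1 : vnorm u = 1 := hu ▸ vnorm_normalize hv
  rw [← hu]
  have hpt : ∀ N ∈ {N : Fin d → Fin d → ℝ | |ε * ((Matrix.of N *ᵥ u) ⬝ᵥ u)| ≤ 1 / 2},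
      (ENNReal.ofReal (vnorm (layer ε N *ᵥ v) ^ (2 * m)))⁻¹ ≤
        (ENNReal.ofReal (vnorm v ^ (2 * m)))⁻¹ * ENNReal.ofReal (Real.exp
          (-(2 * m * ε) * ((Matrix.of N *ᵥ u) ⬝ᵥ u) +
            2 * m * ε ^ 2 * ((Matrix.of N *ᵥ u) ⬝ᵥ u) ^ 2)) := by
    intro N hN
    set g := (Matrix.of N *ᵥ u) ⬝ᵥ u with hg
    have hx : |ε * g| ≤ 1 / 2 := hN
    -- Only the component of the image along `u` is kept, so a single scalar Gaussian `g` governs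
    -- the lower bound.
    have h1 : vnorm v * Real.exp (ε * g - (ε * g) ^ 2) ≤ vnorm (layer ε N *ᵥ v) := by
      rw [layer_mulVec ε N hv, ← hu, vnorm_smul, abs_of_nonneg hvp.le]
      refine mul_le_mul_of_nonneg_left ((exp_sub_sq_le hx).trans ?_) hvp.le
      have h2 := abs_dotProduct_le (u + ε • (Matrix.of N *ᵥ u)) u
      rw [hu1, mul_one, add_dotProduct, smul_dotProduct, ← vnorm_sq_eq_dotProduct, hu1, ← hg] at h2
      refine le_trans ?_ ((le_abs_self _).trans h2)
      simp
    have h3 : vnorm v ^ (2 * m) * Real.exp (-(-(2 * m * ε) * g + 2 * m * ε ^ 2 * g ^ 2)) ≤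
        vnorm (layer ε N *ᵥ v) ^ (2 * m) := by
      refine le_trans (le_of_eq ?_) (pow_le_pow_left₀ (by positivity) h1 (2 * m))
      rw [mul_pow, ← Real.exp_nat_mul]
      congr 2
      push_cast; ring
    rw [← ENNReal.ofReal_inv_of_pos hvm, ← ENNReal.ofReal_mul (inv_nonneg.2 hvm.le),
      ← ENNReal.ofReal_inv_of_pos (lt_of_lt_of_le (mul_pos hvm (Real.exp_pos _)) h3)]
    refine ENNReal.ofReal_le_ofReal ((inv_anti₀ (mul_pos hvm (Real.exp_pos _)) h3).trans (le_of_eq ?_))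
    rw [mul_inv, Real.exp_neg, inv_inv]
  have hmeas : Measurable fun x : ℝ =>
      ENNReal.ofReal (Real.exp (-(2 * m * ε) * x + 2 * m * ε ^ 2 * x ^ 2)) := by fun_prop
  have hquad : Measurable (fun N : Fin d → Fin d → ℝ => (Matrix.of N *ᵥ u) ⬝ᵥ u) := by
    have hm : Measurable (fun x : Fin d → ℝ => x ⬝ᵥ u) := by
      unfold dotProduct; fun_prop
    exact hm.comp (measurable_mulVec u)
  refine (setLIntegral_mono' (measurableSet_small_layer ε u) hpt).trans ?_
  refine (setLIntegral_le_lintegral _ _).trans ?_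
  rw [lintegral_const_mul' _ _ (by
    rw [ENNReal.inv_ne_top, ne_eq, ENNReal.ofReal_eq_zero, not_le]; exact hvm), mul_comm]
  gcongr
  rw [← lintegral_map (f := fun x : ℝ => ENNReal.ofReal (Real.exp
    (-(2 * m * ε) * x + 2 * m * ε ^ 2 * x ^ 2))) hmeas hquad, map_quadForm_gaussMat hu1]
  refine (lintegral_exp_quadratic_le (-(2 * m * ε)) (by positivity) hm).trans ?_
  refine ENNReal.ofReal_le_ofReal (Real.exp_le_exp.2 (le_of_eq (by ring)))

/-- Degenerate layers are unlikely. -/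
lemma gaussMat_degenerate_le {ε : ℝ} (K : ℝ) {u : Fin d → ℝ} (hu : vnorm u = 1) :
    gaussMat d {N : Fin d → Fin d → ℝ | |ε * ((Matrix.of N *ᵥ u) ⬝ᵥ u)| ≤ 1 / 2}ᶜ ≤
      ENNReal.ofReal (2 * Real.exp (4 * K ^ 2 * ε ^ 2 - |K|)) := by
  have hquad : Measurable (fun N : Fin d → Fin d → ℝ => (Matrix.of N *ᵥ u) ⬝ᵥ u) := by
    have hm : Measurable (fun x : Fin d → ℝ => x ⬝ᵥ u) := by
      unfold dotProduct; fun_prop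
    exact hm.comp (measurable_mulVec u)
  have hms : MeasurableSet {x : ℝ | |ε * x| ≤ 1 / 2}ᶜ :=
    (measurableSet_le (by fun_prop) measurable_const).compl
  have h1 : gaussMat d {N : Fin d → Fin d → ℝ | |ε * ((Matrix.of N *ᵥ u) ⬝ᵥ u)| ≤ 1 / 2}ᶜ =
      gaussianReal 0 1 {x : ℝ | |ε * x| ≤ 1 / 2}ᶜ := by
    rw [← map_quadForm_gaussMat hu, Measure.map_apply hquad hms]; rfl
  have hint : ∀ a : ℝ, ∫⁻ x, ENNReal.ofReal (Real.exp (a * x)) ∂(gaussianReal 0 1) ≤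
      ENNReal.ofReal (Real.exp (a ^ 2)) := by
    intro a
    have := lintegral_exp_quadratic_le a le_rfl (by norm_num)
    simpa using this
  rw [h1]
  calc gaussianReal 0 1 {x : ℝ | |ε * x| ≤ 1 / 2}ᶜ
      = ∫⁻ x in {x : ℝ | |ε * x| ≤ 1 / 2}ᶜ, 1 ∂(gaussianReal 0 1) := by simp
    _ ≤ ∫⁻ x in {x : ℝ | |ε * x| ≤ 1 / 2}ᶜ, ENNReal.ofReal (Real.exp (-|K|)) *
          (ENNReal.ofReal (Real.exp ((2 * |K| * ε) * x)) +
            ENNReal.ofReal (Real.exp ((-(2 * |K| * ε)) * x))) ∂(gaussianReal 0 1) := by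
        -- Chernoff's method for both tails at once: when |εx| > 1/2, one of the exponents -|K| ±
        -- 2|K|εx is nonnegative.
        refine setLIntegral_mono' hms fun x hx => ?_
        have hx' : 1 / 2 < |ε * x| := not_le.1 hx
        rw [← ENNReal.ofReal_add (Real.exp_pos _).le (Real.exp_pos _).le,
          ← ENNReal.ofReal_mul (Real.exp_pos _).le, ← ENNReal.ofReal_one]
        refine ENNReal.ofReal_le_ofReal ?_
        rw [mul_add, ← Real.exp_add, ← Real.exp_add]
        rcases lt_abs.1 hx' with h | h
        · have : 0 ≤ -|K| + 2 * |K| * ε * x := by nlinarith [abs_nonneg K]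
          linarith [Real.one_le_exp this, Real.exp_pos (-|K| + -(2 * |K| * ε) * x)]
        · have : 0 ≤ -|K| + -(2 * |K| * ε) * x := by nlinarith [abs_nonneg K]
          linarith [Real.one_le_exp this, Real.exp_pos (-|K| + (2 * |K| * ε) * x)]
    _ ≤ ∫⁻ x, ENNReal.ofReal (Real.exp (-|K|)) *
          (ENNReal.ofReal (Real.exp ((2 * |K| * ε) * x)) +
            ENNReal.ofReal (Real.exp ((-(2 * |K| * ε)) * x))) ∂(gaussianReal 0 1) :=
        setLIntegral_le_lintegral _ _
    _ ≤ ENNReal.ofReal (Real.exp (-|K|)) * (ENNReal.ofReal (Real.exp ((2 * |K| * ε) ^ 2)) +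
          ENNReal.ofReal (Real.exp ((-(2 * |K| * ε)) ^ 2))) := by
        rw [lintegral_const_mul' _ _ ENNReal.ofReal_ne_top, lintegral_add_left (by fun_prop)]
        gcongr
        · exact hint _
        · exact hint _
    _ = _ := by
        rw [← ENNReal.ofReal_add (Real.exp_pos _).le (Real.exp_pos _).le,
          ← ENNReal.ofReal_mul (Real.exp_pos _).le]
        congr 1
        have e1 : (2 * |K| * ε) ^ 2 = 4 * K ^ 2 * ε ^ 2 := by
          rw [mul_pow, mul_pow, sq_abs]; ring
        rw [neg_sq, e1, sub_eq_add_neg, Real.exp_add]; ring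

end Gaussian

/-! ### Maximal inequality over depth. -/

section Maximal

variable {L d : ℕ}

/-- A stack of residual Gaussian layers. -/
def layers (ε : ℝ) (N : Fin L → Fin d → Fin d → ℝ) : Params L d := fun k => layer ε (N k)

lemma measurable_prefixProd_mulVec (ε : ℝ) (k : ℕ) (v : Fin d → ℝ) :
    Measurable fun N : Fin L → Fin d → Fin d → ℝ => prefixProd (layers ε N) k *ᵥ v := by
  have hcont : Continuous fun (N : Fin L → Fin d → Fin d → ℝ) (l : Fin L) (i j : Fin d) =>
      layer ε (N l) i j := by
    refine continuous_pi fun l => continuous_pi fun i => continuous_pi fun j => ?_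
    simp only [layer, Matrix.add_apply, Matrix.smul_apply, of_apply]
    fun_prop
  refine measurable_pi_lambda _ fun i => ?_
  simp only [mulVec, dotProduct]
  refine Finset.measurable_sum _ fun j _ => Measurable.mul_const ?_ _
  exact ((contDiff_prefixProd k i j).continuous.comp hcont).measurable

lemma layers_cons (ε : ℝ) (A : Fin d → Fin d → ℝ) (N : Fin L → Fin d → Fin d → ℝ) :
    layers ε (Fin.cons A N : Fin (L + 1) → Fin d → Fin d → ℝ) =
      Fin.cons (layer ε A) (layers ε N) := by
  funext k
  refine Fin.cases ?_ (fun k => ?_) k <;> simp [layers]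

/-- A set of weights of a deeper stack, measured by conditioning on the first layer. -/
lemma pi_gaussMat_succ {E : Set (Fin (L + 1) → Fin d → Fin d → ℝ)} (hE : MeasurableSet E) :
    Measure.pi (fun _ : Fin (L + 1) => gaussMat d) E =
      ∫⁻ A, Measure.pi (fun _ : Fin L => gaussMat d) {N | (Fin.cons A N :
        Fin (L + 1) → Fin d → Fin d → ℝ) ∈ E} ∂(gaussMat d) := by
  have h := (measurePreserving_piFinSuccAbove (fun _ : Fin (L + 1) => gaussMat d) 0).symm
  rw [← h.measure_preimage_equiv, Measure.prod_apply ((MeasurableEquiv.measurable _) hE)]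
  refine lintegral_congr fun A => ?_
  congr 1
  ext N
  simp only [Set.mem_preimage, MeasurableEquiv.piFinSuccAbove_symm_apply, Fin.insertNthEquiv_zero]
  rfl

/-- Maximal inequality for multiplicative functionals of the products of the first layers. -/
lemma maximal_prefixProd {φ : (Fin d → ℝ) → ENNReal} (hφ : Measurable φ) {ε : ℝ}
    {c δ K : ENNReal} (hc : 1 ≤ c) (hK0 : K ≠ 0) (hK : K ≠ ⊤)
    (hstep : ∀ v, ∃ D : Set (Fin d → Fin d → ℝ), MeasurableSet D ∧ gaussMat d Dᶜ ≤ δ ∧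
      ∫⁻ A in D, φ (layer ε A *ᵥ v) ∂(gaussMat d) ≤ c * φ v) (L : ℕ) (v : Fin d → ℝ) :
    Measure.pi (fun _ : Fin L => gaussMat d)
      {N | ∃ k ≤ L, K ≤ φ (prefixProd (layers ε N) k *ᵥ v)} ≤ L * δ + c ^ L * φ v / K := by
  -- If the threshold is already met at depth 0, the bound is trivial. Otherwise it can only be met
  -- after the first layer, and induction applies to the image of `v` under that layer.
  have hbig : ∀ (L : ℕ) v, K ≤ φ v → 1 ≤ L * δ + c ^ L * φ v / K := by
    intro L v h
    refine le_trans ?_ le_add_self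
    rw [ENNReal.le_div_iff_mul_le (Or.inl hK0) (Or.inl hK), one_mul]
    exact h.trans (le_mul_of_one_le_left zero_le (one_le_pow₀ hc))
  induction L generalizing v with
  | zero =>
    by_cases h : K ≤ φ v
    · exact prob_le_one.trans (hbig 0 v h)
    · have : {N : Fin 0 → Fin d → Fin d → ℝ | ∃ k ≤ 0, K ≤ φ (prefixProd (layers ε N) k *ᵥ v)} = ∅ := by
        ext N
        simp [prefixProd_zero, h]
      rw [this, measure_empty]
      exact zero_le
  | succ L ih =>
    by_cases h : K ≤ φ v
    · exact prob_le_one.trans (hbig (L + 1) v h)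
    have hmeas : MeasurableSet {N : Fin (L + 1) → Fin d → Fin d → ℝ |
        ∃ k ≤ L + 1, K ≤ φ (prefixProd (layers ε N) k *ᵥ v)} := by
      have : {N : Fin (L + 1) → Fin d → Fin d → ℝ |
          ∃ k ≤ L + 1, K ≤ φ (prefixProd (layers ε N) k *ᵥ v)} = ⋃ k ∈ Set.Iic (L + 1),
            {N | K ≤ φ (prefixProd (layers ε N) k *ᵥ v)} := by
        ext N; simp
      rw [this]
      refine MeasurableSet.biUnion (Set.to_countable _) fun k _ => ?_
      exact measurableSet_le measurable_const (hφ.comp (measurable_prefixProd_mulVec ε k v))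
    rw [pi_gaussMat_succ hmeas]
    have hsub : ∀ A, {N : Fin L → Fin d → Fin d → ℝ |
        (Fin.cons A N : Fin (L + 1) → Fin d → Fin d → ℝ) ∈ {N : Fin (L + 1) → Fin d → Fin d → ℝ |
          ∃ k ≤ L + 1, K ≤ φ (prefixProd (layers ε N) k *ᵥ v)}} ⊆
        {N | ∃ k ≤ L, K ≤ φ (prefixProd (layers ε N) k *ᵥ (layer ε A *ᵥ v))} := by
      rintro A N ⟨k, hk, hkφ⟩
      rcases k with - | k
      · rw [prefixProd_zero, one_mulVec] at hkφ
        exact absurd hkφ h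
      · rw [layers_cons, prefixProd_cons, ← mulVec_mulVec] at hkφ
        exact ⟨k, by omega, hkφ⟩
    obtain ⟨D, hD, hDδ, hDint⟩ := hstep v
    have hφm : Measurable fun A : Fin d → Fin d → ℝ => φ (layer ε A *ᵥ v) := by
      refine hφ.comp ?_
      have : (fun A : Fin d → Fin d → ℝ => layer ε A *ᵥ v) =
          fun A => v + ε • (Matrix.of A *ᵥ v) := by
        ext A : 1; rw [layer, add_mulVec, one_mulVec, smul_mulVec]
      rw [this]
      exact (measurable_const.add ((measurable_mulVec v).const_smul ε))
    rw [← lintegral_add_compl _ hD]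
    calc _ ≤ ∫⁻ A in D, (L * δ + c ^ L * φ (layer ε A *ᵥ v) / K) ∂(gaussMat d) +
          ∫⁻ A in Dᶜ, 1 ∂(gaussMat d) := by
          refine add_le_add (lintegral_mono fun A => ?_) (lintegral_mono fun A => prob_le_one)
          exact (measure_mono (hsub A)).trans (ih _)
      _ ≤ (L * δ + c ^ L * (c * φ v) / K) + δ := by
          rw [lintegral_const, Measure.restrict_apply MeasurableSet.univ, Set.univ_inter, one_mul]
          refine add_le_add ?_ hDδ
          rw [lintegral_add_left measurable_const, lintegral_const]
          refine add_le_add (mul_le_of_le_one_right zero_le (by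
            rw [Measure.restrict_apply MeasurableSet.univ]; exact prob_le_one)) ?_
          simp_rw [mul_div_assoc, div_eq_mul_inv]
          rw [lintegral_const_mul _ (hφm.mul_const _), lintegral_mul_const _ hφm]
          rw [← mul_assoc c (φ v)]
          exact mul_le_mul_right (mul_le_mul_left hDint _) _
      _ = _ := by
          rw [pow_succ]; push_cast
          rw [mul_assoc (c ^ L)]; ring

end Maximal

/-! ### Nets of the unit sphere. -/

section Net

open Metric in
/-- A volume bound for the number of separated unit vectors. -/
lemma card_le_of_separated_unit {E : Type*} [NormedAddCommGroup E] [NormedSpace ℝ E]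
    [FiniteDimensional ℝ E] {η : ℝ} (hη : 0 < η) (s : Finset E) (hs : ∀ c ∈ s, ‖c‖ ≤ 1)
    (h : ∀ c ∈ s, ∀ e ∈ s, c ≠ e → η ≤ ‖c - e‖) :
    (s.card : ℝ) ≤ (1 + 2 / η) ^ Module.finrank ℝ E := by
  borelize E
  let μ : Measure E := Measure.addHaar
  have δpos : 0 < η / 2 := by positivity
  have ρpos : 0 < 1 + η / 2 := by positivity
  have D : Set.Pairwise (s : Set E) (Function.onFun Disjoint fun c => ball (c : E) (η / 2)) := by
    rintro c hc e he hce
    apply ball_disjoint_ball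
    rw [dist_eq_norm, add_halves]
    exact h c hc e he hce
  have A_subset : (⋃ c ∈ s, ball (c : E) (η / 2)) ⊆ ball (0 : E) (1 + η / 2) := by
    refine Set.iUnion₂_subset fun x hx => ball_subset_ball' ?_
    rw [dist_zero_right, add_comm]
    linarith [hs x hx]
  have I : (s.card : ENNReal) * ENNReal.ofReal ((η / 2) ^ Module.finrank ℝ E) * μ (ball 0 1) ≤
      ENNReal.ofReal ((1 + η / 2) ^ Module.finrank ℝ E) * μ (ball 0 1) :=
    calc _ = μ (⋃ c ∈ s, ball (c : E) (η / 2)) := by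
          rw [measure_biUnion_finset D fun c _ => measurableSet_ball]
          simp only [μ.addHaar_ball_of_pos _ δpos, Finset.sum_const, nsmul_eq_mul, mul_assoc]
      _ ≤ μ (ball (0 : E) (1 + η / 2)) := measure_mono A_subset
      _ = _ := by rw [μ.addHaar_ball_of_pos _ ρpos]
  have J : (s.card : ENNReal) * ENNReal.ofReal ((η / 2) ^ Module.finrank ℝ E) ≤
      ENNReal.ofReal ((1 + η / 2) ^ Module.finrank ℝ E) :=
    (ENNReal.mul_le_mul_iff_left (measure_ball_pos _ _ zero_lt_one).ne' measure_ball_lt_top.ne).1 I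
  have K := ENNReal.toReal_le_of_le_ofReal (pow_nonneg ρpos.le _) J
  rw [ENNReal.toReal_mul, ENNReal.toReal_natCast, ENNReal.toReal_ofReal (by positivity),
    ← le_div_iff₀ (by positivity), ← div_pow] at K
  refine K.trans (le_of_eq ?_)
  congr 1
  field_simp
  ring

/-- The unit sphere has a small net. -/
lemma exists_net (d : ℕ) {η : ℝ} (hη : 0 < η) : ∃ s : Finset (Fin d → ℝ),
    (s.card : ℝ) ≤ (1 + 2 / η) ^ d ∧ (∀ u ∈ s, vnorm u = 1) ∧
      ∀ u, vnorm u = 1 → ∃ u' ∈ s, vnorm (u - u') ≤ η := by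
  classical
  let P : ℕ → Prop := fun n => ∃ s : Finset (EuclideanSpace ℝ (Fin d)), s.card = n ∧
    (∀ c ∈ s, ‖c‖ = 1) ∧ ∀ c ∈ s, ∀ e ∈ s, c ≠ e → η ≤ ‖c - e‖
  have hbound : ∀ n, P n → (n : ℝ) ≤ (1 + 2 / η) ^ d := by
    rintro n ⟨s, rfl, h1, h2⟩
    have := card_le_of_separated_unit hη s (fun c hc => (h1 c hc).le) h2
    rwa [finrank_euclideanSpace_fin] at this
  have hP0 : P 0 := ⟨∅, by simp, by simp, by simp⟩
  have hPb : ∀ n, P n → n ≤ ⌈(1 + 2 / η) ^ d⌉₊ := fun n hn => by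
    exact_mod_cast (hbound n hn).trans (Nat.le_ceil _)
  -- A separated set of maximal cardinality is a net: a unit vector far from all its points could be
  -- added to it.
  obtain ⟨s, hcard, h1, h2⟩ : P (Nat.findGreatest P ⌈(1 + 2 / η) ^ d⌉₊) :=
    Nat.findGreatest_spec (Nat.zero_le _) hP0
  refine ⟨s.image WithLp.ofLp, ?_, ?_, ?_⟩
  · have := hbound _ ⟨s, hcard, h1, h2⟩
    rw [← hcard] at this
    refine le_trans ?_ this
    exact_mod_cast Finset.card_image_le
  · intro u hu
    obtain ⟨c, hc, rfl⟩ := Finset.mem_image.1 hu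
    exact h1 c hc
  · intro u hu
    by_contra hcon
    push Not at hcon
    have hfar : ∀ c ∈ s, η < ‖WithLp.toLp 2 u - c‖ := fun c hc =>
      hcon (WithLp.ofLp c) (Finset.mem_image_of_mem _ hc)
    have hnot : WithLp.toLp 2 u ∉ s := fun hmem => by
      have := hfar _ hmem
      rw [sub_self, norm_zero] at this
      linarith
    have hPs : P (s.card + 1) := by
      refine ⟨insert (WithLp.toLp 2 u) s, Finset.card_insert_of_notMem hnot, ?_, ?_⟩
      · intro c hc
        rcases Finset.mem_insert.1 hc with rfl | hc
        · exact hu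
        · exact h1 c hc
      · intro c hc e he hce
        rcases Finset.mem_insert.1 hc with rfl | hc <;> rcases Finset.mem_insert.1 he with rfl | he
        · exact absurd rfl hce
        · exact (hfar e he).le
        · rw [norm_sub_rev]; exact (hfar c hc).le
        · exact h2 c hc e he hce
    have := Nat.le_findGreatest (hPb _ hPs) hPs
    omega

/-- Two-sided bounds on a fine net of the sphere extend to the whole space. -/
lemma twoSided_of_net {d : ℕ} {s : Finset (Fin d → ℝ)} {a b : ℝ} (ha : 0 < a) (hab : a ≤ b)
    (hnet : ∀ u, vnorm u = 1 → ∃ u' ∈ s, vnorm (u - u') ≤ a / (4 * b))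
    {T : Matrix (Fin d) (Fin d) ℝ}
    (hT : ∀ u ∈ s, a ≤ vnorm (T *ᵥ u) ∧ vnorm (T *ᵥ u) ≤ b) {c : ℝ} (hcb : 2 * b ≤ c)
    (hca : 2 / a ≤ c) : TwoSided T c := by
  have hb : 0 < b := ha.trans_le hab
  set T' := Matrix.toEuclideanCLM (n := Fin d) (𝕜 := ℝ) T with hT'
  have hTv : ∀ v, vnorm (T *ᵥ v) = ‖T' (WithLp.toLp 2 v)‖ := fun v => by
    rw [hT', Matrix.toEuclideanCLM_toLp]; rfl
  have hη : a / (4 * b) ≤ 1 / 2 := by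
    rw [div_le_iff₀ (by positivity)]; linarith
  have hop : ∀ v, vnorm (T *ᵥ v) ≤ ‖T'‖ * vnorm v := fun v => by
    rw [hTv]; exact T'.le_opNorm _
  have hclose : ∀ u, vnorm u = 1 → ∃ u' ∈ s, vnorm (T *ᵥ (u - u')) ≤ ‖T'‖ * (a / (4 * b)) := by
    intro u hu
    obtain ⟨u', hu', h⟩ := hnet u hu
    exact ⟨u', hu', (hop _).trans (mul_le_mul_of_nonneg_left h (norm_nonneg _))⟩
  have hnorm : ‖T'‖ ≤ 2 * b := by
    -- The unknown norm is bounded by itself: the mesh is at most 1/2, so the net error is absorbed.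
    -- With ‖T'‖ ≤ 2b in hand, the mesh a/(4b) costs only a/2 in the lower bound.
    have h1 : ‖T'‖ ≤ b + ‖T'‖ / 2 := by
      refine ContinuousLinearMap.opNorm_le_of_unit_norm (by positivity) fun x hx => ?_
      obtain ⟨u', hu', h⟩ := hclose (WithLp.ofLp x) hx
      have h2 : ‖T' x‖ = vnorm (T *ᵥ WithLp.ofLp x) := (hTv _).symm
      have h3 := vnorm_add_le (T *ᵥ u') (T *ᵥ (WithLp.ofLp x - u'))
      rw [← mulVec_add, add_sub_cancel] at h3
      rw [h2]
      have := mul_le_mul_of_nonneg_left hη (norm_nonneg T')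
      linarith [(hT u' hu').2]
    linarith
  have hlow : ∀ u, vnorm u = 1 → a / 2 ≤ vnorm (T *ᵥ u) := by
    intro u hu
    obtain ⟨u', hu', h⟩ := hclose u hu
    have h3 := vnorm_add_le (T *ᵥ u) (T *ᵥ (u' - u))
    rw [← mulVec_add, add_sub_cancel] at h3
    have h4 : vnorm (T *ᵥ (u' - u)) = vnorm (T *ᵥ (u - u')) := by
      rw [← neg_sub, mulVec_neg, ← neg_one_smul ℝ, vnorm_smul]; simp
    have h5 : ‖T'‖ * (a / (4 * b)) ≤ 2 * b * (a / (4 * b)) :=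
      mul_le_mul_of_nonneg_right hnorm (by positivity)
    have h6 : 2 * b * (a / (4 * b)) = a / 2 := by field_simp; norm_num
    linarith [(hT u' hu').1]
  refine TwoSided.of_bounds (fun v => (hop v).trans
    (mul_le_mul_of_nonneg_right (hnorm.trans hcb) (vnorm_nonneg v))) fun v => ?_
  rcases eq_or_ne v 0 with rfl | hv
  · simp
  · have h1 := hlow _ (vnorm_normalize hv)
    have hvp := vnorm_pos hv
    rw [mulVec_smul, vnorm_smul, abs_of_pos (inv_pos.2 hvp), ← div_eq_inv_mul, le_div_iff₀ hvp] at h1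
    calc vnorm v = 2 / a * (a / 2 * vnorm v) := by field_simp
      _ ≤ 2 / a * vnorm (T *ᵥ v) := mul_le_mul_of_nonneg_left h1 (by positivity)
      _ ≤ c * vnorm (T *ᵥ v) := mul_le_mul_of_nonneg_right hca (vnorm_nonneg _)

end Net

/-! ### The event of well-conditioned partial products. -/

section Event

variable {L d : ℕ}

lemma sq_div_sqrt (s : ℝ) (L d : ℕ) : (s / Real.sqrt ((L : ℝ) * d)) ^ 2 = s ^ 2 / (L * d) := by
  rw [div_pow, Real.sq_sqrt (by positivity)]

/-- The partial products do not blow up a fixed vector. -/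
lemma prefixProd_upper {s : ℝ} (hL : 0 < L) (hd : 0 < d) (hsL : 4 * s ^ 2 ≤ L) (α : ℝ)
    {u : Fin d → ℝ} (hu : vnorm u = 1) :
    Measure.pi (fun _ : Fin L => gaussMat d)
      {N | ∃ k ≤ L, Real.exp α ≤ vnorm (prefixProd (layers (s / Real.sqrt ((L : ℝ) * d)) N) k *ᵥ u)} ≤
      ENNReal.ofReal (Real.exp (d * (6 * s ^ 2 - 2 * α))) := by
  have hL' : (0 : ℝ) < L := by exact_mod_cast hL
  have hd' : (0 : ℝ) < d := by exact_mod_cast hd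
  set ε := s / Real.sqrt ((L : ℝ) * d) with hε
  have hε2 : ε ^ 2 = s ^ 2 / (L * d) := sq_div_sqrt s L d
  have hm : (d : ℝ) * ε ^ 2 ≤ 1 / 4 := by
    rw [hε2]
    have : (d : ℝ) * (s ^ 2 / (L * d)) = s ^ 2 / L := by field_simp
    rw [this, div_le_iff₀ hL']; linarith
  -- The moment order is 2d, so the growth over all `L` layers is exp(6s²d) while Markov's
  -- inequality gains exp(-2αd). No layer is discarded.
  set c := Real.exp (2 * d * (d * ε ^ 2) + 4 * (d : ℝ) ^ 2 * ε ^ 2) with hc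
  have hcL : c ^ L = Real.exp (d * (6 * s ^ 2)) := by
    rw [hc, ← Real.exp_nat_mul, hε2]
    congr 1
    field_simp; norm_num
  have hφm : Measurable fun v : Fin d → ℝ => ENNReal.ofReal (vnorm v ^ (2 * d)) :=
    (measurable_vnorm.pow_const _).ennreal_ofReal
  have hKpos : 0 < Real.exp α ^ (2 * d) := by positivity
  have h := maximal_prefixProd hφm (ε := ε) (c := ENNReal.ofReal c) (δ := 0)
    (K := ENNReal.ofReal (Real.exp α ^ (2 * d)))
    (by rw [← ENNReal.ofReal_one]; exact ENNReal.ofReal_le_ofReal (Real.one_le_exp (by positivity)))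
    (by rw [ne_eq, ENNReal.ofReal_eq_zero, not_le]; exact hKpos) ENNReal.ofReal_ne_top
    (fun v => ⟨Set.univ, MeasurableSet.univ, by simp, by
      rw [Measure.restrict_univ]; exact lintegral_vnorm_pow_layer_le hm v⟩) L u
  refine le_trans (measure_mono ?_) (h.trans (le_of_eq ?_))
  · rintro N ⟨k, hk, hN⟩
    exact ⟨k, hk, ENNReal.ofReal_le_ofReal (pow_le_pow_left₀ (Real.exp_pos _).le hN _)⟩
  · rw [hu, one_pow, ENNReal.ofReal_one, mul_one, mul_zero, zero_add,
      ← ENNReal.ofReal_pow (Real.exp_pos _).le, ← ENNReal.ofReal_div_of_pos hKpos, hcL,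
      ← Real.exp_nat_mul, ← Real.exp_sub]
    congr 2
    push_cast; ring

/-- The partial products do not shrink a fixed vector. -/
lemma prefixProd_lower {s : ℝ} (hL : 0 < L) (hd : 0 < d) (hsL : 16 * s ^ 2 ≤ L) (β : ℝ)
    {u : Fin d → ℝ} (hu : vnorm u = 1) :
    Measure.pi (fun _ : Fin L => gaussMat d)
      {N | ∃ k ≤ L, vnorm (prefixProd (layers (s / Real.sqrt ((L : ℝ) * d)) N) k *ᵥ u) ≤
        Real.exp (-β)} ≤
      ENNReal.ofReal (2 * L * Real.exp (-(d * L / (16 * (s ^ 2 + 1)))) +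
        Real.exp (d * (24 * s ^ 2 - 4 * β))) := by
  have hL' : (0 : ℝ) < L := by exact_mod_cast hL
  have hd1 : (1 : ℝ) ≤ d := by exact_mod_cast hd
  have hd' : (0 : ℝ) < d := by linarith
  set ε := s / Real.sqrt ((L : ℝ) * d) with hε
  have hε2 : ε ^ 2 = s ^ 2 / (L * d) := sq_div_sqrt s L d
  have hm : 2 * ((2 * d : ℕ) : ℝ) * ε ^ 2 ≤ 1 / 4 := by
    rw [hε2]; push_cast
    have : 2 * (2 * (d : ℝ)) * (s ^ 2 / (L * d)) = 4 * s ^ 2 / L := by field_simp; ring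
    rw [this, div_le_iff₀ hL']; linarith
  set c := Real.exp (4 * ((2 * d : ℕ) : ℝ) * ε ^ 2 + 4 * ((2 * d : ℕ) : ℝ) ^ 2 * ε ^ 2) with hc
  have hcL : c ^ L ≤ Real.exp (d * (24 * s ^ 2)) := by
    rw [hc, ← Real.exp_nat_mul, hε2]
    refine Real.exp_le_exp.2 ?_
    have : (L : ℝ) * (4 * ((2 * d : ℕ) : ℝ) * (s ^ 2 / (L * d)) +
        4 * ((2 * d : ℕ) : ℝ) ^ 2 * (s ^ 2 / (L * d))) = 8 * s ^ 2 + 16 * s ^ 2 * d := by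
      push_cast; field_simp; ring
    rw [this]
    nlinarith [sq_nonneg s]
  set δ := 2 * Real.exp (-(d * L / (16 * (s ^ 2 + 1)))) with hδ
  have hc1 : 1 ≤ ENNReal.ofReal c := by
    rw [← ENNReal.ofReal_one]; exact ENNReal.ofReal_le_ofReal (Real.one_le_exp (by positivity))
  have hφm : Measurable fun v : Fin d → ℝ => (ENNReal.ofReal (vnorm v ^ (2 * (2 * d))))⁻¹ :=
    (measurable_vnorm.pow_const _).ennreal_ofReal.inv
  have hKpos : 0 < Real.exp (-β) ^ (2 * (2 * d)) := by positivity
  have hδε : ∀ u : Fin d → ℝ, vnorm u = 1 → gaussMat d {N : Fin d → Fin d → ℝ |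
      |ε * ((Matrix.of N *ᵥ u) ⬝ᵥ u)| ≤ 1 / 2}ᶜ ≤ ENNReal.ofReal δ := by
    intro u hu
    -- With this K, 4K²ε² ≤ K/2, so the exponent is at most -K/2, which is linear in dL.
    refine (gaussMat_degenerate_le (d * L / (8 * (s ^ 2 + 1))) hu).trans
      (ENNReal.ofReal_le_ofReal ?_)
    rw [hδ, abs_of_nonneg (by positivity), hε2]
    refine mul_le_mul_of_nonneg_left (Real.exp_le_exp.2 ?_) (by norm_num)
    have e : 4 * (d * L / (8 * (s ^ 2 + 1))) ^ 2 * (s ^ 2 / (L * d)) =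
        d * L / (16 * (s ^ 2 + 1)) * (s ^ 2 / (s ^ 2 + 1)) := by
      field_simp; ring
    have e2 : (d : ℝ) * L / (8 * (s ^ 2 + 1)) = 2 * (d * L / (16 * (s ^ 2 + 1))) := by
      field_simp; norm_num
    rw [e, e2]
    have h1 : s ^ 2 / (s ^ 2 + 1) ≤ 1 := by
      rw [div_le_one (by positivity)]; linarith
    have h2 : 0 ≤ (d : ℝ) * L / (16 * (s ^ 2 + 1)) := by positivity
    nlinarith
  have h := maximal_prefixProd hφm (ε := ε) (c := ENNReal.ofReal c) (δ := ENNReal.ofReal δ)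
    (K := (ENNReal.ofReal (Real.exp (-β) ^ (2 * (2 * d))))⁻¹) hc1
    (by rw [ENNReal.inv_ne_zero]; exact ENNReal.ofReal_ne_top)
    (by rw [ENNReal.inv_ne_top, ne_eq, ENNReal.ofReal_eq_zero, not_le]; exact hKpos)
    (fun v => by
      rcases eq_or_ne v 0 with rfl | hv
      · refine ⟨Set.univ, MeasurableSet.univ, by simp, ?_⟩
        have h0 : (ENNReal.ofReal (vnorm (0 : Fin d → ℝ) ^ (2 * (2 * d))))⁻¹ = ⊤ := by
          rw [vnorm_zero, zero_pow (by omega)]; simp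
        rw [h0, ENNReal.mul_top (zero_lt_one.trans_le hc1).ne']
        exact le_top
      · exact ⟨_, measurableSet_small_layer ε _, hδε _ (vnorm_normalize hv),
          setLIntegral_inv_vnorm_pow_layer_le hm hv⟩) L u
  refine le_trans (measure_mono ?_) (h.trans ?_)
  · rintro N ⟨k, hk, hN⟩
    exact ⟨k, hk, ENNReal.inv_le_inv.2
      (ENNReal.ofReal_le_ofReal (pow_le_pow_left₀ (vnorm_nonneg _) hN _))⟩
  · rw [hu, one_pow, ENNReal.ofReal_one, inv_one, mul_one, div_eq_mul_inv, inv_inv,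
      ← ENNReal.ofReal_pow (Real.exp_pos _).le, ← ENNReal.ofReal_mul (by positivity),
      ← ENNReal.ofReal_natCast, ← ENNReal.ofReal_mul (by positivity),
      ← ENNReal.ofReal_add (by positivity) (by positivity)]
    refine ENNReal.ofReal_le_ofReal (add_le_add (le_of_eq (by rw [hδ]; ring)) ?_)
    refine (mul_le_mul_of_nonneg_right hcL hKpos.le).trans (le_of_eq ?_)
    rw [← Real.exp_nat_mul, ← Real.exp_add]
    congr 1
    push_cast; ring

/-- With overwhelming probability all products of the first layers are well-conditioned, with
a bound that does not depend on depth and width. -/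
lemma exists_wellConditioned_event (s : ℝ) : ∃ A C : ℝ, 0 < A ∧ 0 < C ∧ ∀ L d : ℕ, C ≤ L → 0 < d →
    ∃ E : Set (Fin L → Fin d → Fin d → ℝ), MeasurableSet E ∧
      Measure.pi (fun _ : Fin L => gaussMat d) Eᶜ ≤ ENNReal.ofReal (3 * Real.exp (-d)) ∧
      ∀ N ∈ E, ∀ k ≤ L, TwoSided (prefixProd (layers (s / Real.sqrt ((L : ℝ) * d)) N) k) A := by
  -- `α` and `β` solve 2α - 6s² = 4 + α + β and 4β - 24s² = 4 + α + β. Both tails then beat the net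
  -- size exp(d(3 + α + β)) by a factor exp(-d).
  obtain ⟨β, hβ⟩ : ∃ β, β = 15 * s ^ 2 + 4 := ⟨_, rfl⟩
  obtain ⟨α, hα⟩ : ∃ α, α = 21 * s ^ 2 + 8 := ⟨_, rfl⟩
  have hα0 : 0 < α := by rw [hα]; positivity
  have hβ0 : 0 < β := by rw [hβ]; positivity
  set κ : ℝ := 1 / (16 * (s ^ 2 + 1)) with hκ
  have hκ0 : 0 < κ := by positivity
  refine ⟨2 * Real.exp (α + β), 2 * (4 + α + β + 4 / κ) / κ + 16 * s ^ 2, by positivity,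
    by positivity, fun L d hCL hd => ?_⟩
  have hd1 : (1 : ℝ) ≤ d := by exact_mod_cast hd
  have hLpos : (0 : ℝ) < L := lt_of_lt_of_le (by positivity) hCL
  have hL : 0 < L := by exact_mod_cast hLpos
  have hsL : 16 * s ^ 2 ≤ L := le_trans (le_add_of_nonneg_left (by positivity)) hCL
  have hκL : 4 + α + β + 4 / κ ≤ κ * L / 2 := by
    have : 2 * (4 + α + β + 4 / κ) / κ ≤ L := le_trans (le_add_of_nonneg_right (by positivity)) hCL
    rw [div_le_iff₀ hκ0] at this
    linarith
  set ε := s / Real.sqrt ((L : ℝ) * d) with hε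
  obtain ⟨net, hcard, hunit, hnet⟩ := exists_net d (η := Real.exp (-β) / (4 * Real.exp α))
    (by positivity)
  have hcard' : (net.card : ℝ) ≤ Real.exp (d * (3 + α + β)) := by
    refine hcard.trans ?_
    rw [Real.exp_nat_mul]
    refine pow_le_pow_left₀ (by positivity) ?_ d
    have e1 : 2 / (Real.exp (-β) / (4 * Real.exp α)) = 8 * Real.exp (α + β) := by
      rw [Real.exp_neg, Real.exp_add]; field_simp; norm_num
    have e2 : Real.exp (3 + α + β) = Real.exp 3 * Real.exp (α + β) := by
      rw [← Real.exp_add]; congr 1; ring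
    have e3 : (9 : ℝ) ≤ Real.exp 3 := by
      have h1 := Real.quadratic_le_exp_of_nonneg (x := 3 / 2) (by norm_num)
      have h2 : Real.exp 3 = Real.exp (3 / 2) ^ 2 := by rw [← Real.exp_nat_mul]; norm_num
      rw [h2]; nlinarith
    rw [e1, e2]
    have := Real.one_le_exp (by positivity : 0 ≤ α + β)
    nlinarith
  set Up : (Fin d → ℝ) → Set (Fin L → Fin d → Fin d → ℝ) := fun u =>
    {N | ∃ k ≤ L, Real.exp α ≤ vnorm (prefixProd (layers ε N) k *ᵥ u)} with hUp
  set Lo : (Fin d → ℝ) → Set (Fin L → Fin d → Fin d → ℝ) := fun u =>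
    {N | ∃ k ≤ L, vnorm (prefixProd (layers ε N) k *ᵥ u) ≤ Real.exp (-β)} with hLo
  have hmUp : ∀ u, MeasurableSet (Up u) := fun u => by
    have : Up u = ⋃ k ∈ Set.Iic L, {N | Real.exp α ≤ vnorm (prefixProd (layers ε N) k *ᵥ u)} := by
      ext N; simp [hUp]
    rw [this]
    exact MeasurableSet.biUnion (Set.to_countable _) fun k _ => measurableSet_le measurable_const
      (measurable_vnorm.comp (measurable_prefixProd_mulVec ε k u))
  have hmLo : ∀ u, MeasurableSet (Lo u) := fun u => by
    have : Lo u = ⋃ k ∈ Set.Iic L, {N | vnorm (prefixProd (layers ε N) k *ᵥ u) ≤ Real.exp (-β)} := by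
      ext N; simp [hLo]
    rw [this]
    exact MeasurableSet.biUnion (Set.to_countable _) fun k _ => measurableSet_le
      (measurable_vnorm.comp (measurable_prefixProd_mulVec ε k u)) measurable_const
  have hbad : ∀ u ∈ net, Measure.pi (fun _ : Fin L => gaussMat d) (Up u ∪ Lo u) ≤
      ENNReal.ofReal (3 * Real.exp (-(d * (4 + α + β)))) := by
    intro u hu
    refine (measure_union_le _ _).trans ?_
    refine (add_le_add (prefixProd_upper hL hd (by nlinarith [sq_nonneg s]) α (hunit u hu))
      (prefixProd_lower hL hd hsL β (hunit u hu))).trans ?_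
    rw [← ENNReal.ofReal_add (by positivity) (by positivity)]
    refine ENNReal.ofReal_le_ofReal ?_
    have h1 : Real.exp (d * (6 * s ^ 2 - 2 * α)) ≤ Real.exp (-(d * (4 + α + β))) := by
      refine Real.exp_le_exp.2 ?_
      rw [← mul_neg]
      refine mul_le_mul_of_nonneg_left ?_ (by linarith)
      rw [hα, hβ]; nlinarith [sq_nonneg s]
    have h2 : Real.exp (d * (24 * s ^ 2 - 4 * β)) ≤ Real.exp (-(d * (4 + α + β))) := by
      refine Real.exp_le_exp.2 ?_
      rw [← mul_neg]
      refine mul_le_mul_of_nonneg_left ?_ (by linarith)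
      rw [hα, hβ]; nlinarith [sq_nonneg s]
    have h3 : 2 * L * Real.exp (-(d * L / (16 * (s ^ 2 + 1)))) ≤
        Real.exp (-(d * (4 + α + β))) := by
      have e1 : (d : ℝ) * L / (16 * (s ^ 2 + 1)) = d * (κ * L) := by rw [hκ]; field_simp
      -- The union over layers in the degenerate term is absorbed by half of its exponent dκL; the
      -- lower bound `hκL` on the depth makes the other half large enough.
      have e2 : 2 * (L : ℝ) ≤ Real.exp (d * (κ * L / 2 + 4 / κ)) := by
        have h5 : 2 * (L : ℝ) = 4 / κ * (κ * L / 2) := by field_simp; norm_num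
        have h6 := Real.add_one_le_exp (κ * L / 2)
        have h7 := Real.add_one_le_exp (4 / κ)
        have h8 : Real.exp (4 / κ + κ * L / 2) ≤ Real.exp (d * (κ * L / 2 + 4 / κ)) := by
          refine Real.exp_le_exp.2 ?_
          have : 0 ≤ κ * L / 2 + 4 / κ := by positivity
          nlinarith
        refine le_trans ?_ h8
        rw [h5, Real.exp_add]
        exact mul_le_mul (by linarith) (by linarith) (by positivity) (Real.exp_pos _).le
      rw [e1]
      refine (mul_le_mul_of_nonneg_right e2 (Real.exp_pos _).le).trans ?_
      rw [← Real.exp_add]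
      refine Real.exp_le_exp.2 ?_
      nlinarith
    linarith
  refine ⟨(⋃ u ∈ net, (Up u ∪ Lo u))ᶜ,
    (Finset.measurableSet_biUnion _ fun u _ => (hmUp u).union (hmLo u)).compl, ?_, ?_⟩
  · rw [compl_compl]
    refine (measure_biUnion_finset_le _ _).trans ((Finset.sum_le_sum hbad).trans ?_)
    rw [Finset.sum_const, nsmul_eq_mul, ← ENNReal.ofReal_natCast,
      ← ENNReal.ofReal_mul (Nat.cast_nonneg _)]
    refine ENNReal.ofReal_le_ofReal ?_
    refine (mul_le_mul_of_nonneg_right hcard' (by positivity)).trans (le_of_eq ?_)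
    rw [mul_left_comm, ← Real.exp_add]
    congr 2
    ring
  · intro N hN k hk
    refine twoSided_of_net (a := Real.exp (-β)) (b := Real.exp α) (Real.exp_pos _)
      (Real.exp_le_exp.2 (by linarith)) hnet (fun u hu => ?_) ?_ ?_
    · have : N ∉ Up u ∪ Lo u := fun hmem => hN (Set.mem_biUnion hu hmem)
      rw [Set.mem_union, not_or] at this
      constructor
      · by_contra hc
        exact this.2 ⟨k, hk, (not_le.1 hc).le⟩
      · by_contra hc
        exact this.1 ⟨k, hk, (not_le.1 hc).le⟩
    · exact mul_le_mul_of_nonneg_left (Real.exp_le_exp.2 (by linarith)) (by norm_num)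
    · rw [div_eq_mul_inv, ← Real.exp_neg, neg_neg]
      exact mul_le_mul_of_nonneg_left (Real.exp_le_exp.2 (by linarith)) (by norm_num)

end Event

/-! ### Law of the noise and transfer of events. -/

section Law

variable {Ω : Type*} [MeasurableSpace Ω] {P : Measure Ω} {L d : ℕ}

lemma map_uncurry_pi_gaussMat : (Measure.pi (fun _ : Fin L => gaussMat d)).map
    (fun N (q : Fin L × Fin d × Fin d) => N q.1 q.2.1 q.2.2) =
      Measure.pi (fun _ => gaussianReal 0 1) := by
  have hm : Measurable (fun (N : Fin L → Fin d → Fin d → ℝ) (q : Fin L × Fin d × Fin d) =>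
      N q.1 q.2.1 q.2.2) := by fun_prop
  refine (Measure.pi_eq fun t ht => ?_).symm
  rw [Measure.map_apply hm (MeasurableSet.univ_pi ht)]
  have : (fun (N : Fin L → Fin d → Fin d → ℝ) (q : Fin L × Fin d × Fin d) =>
      N q.1 q.2.1 q.2.2) ⁻¹' Set.univ.pi t =
      Set.univ.pi fun k => Set.univ.pi fun i => Set.univ.pi fun j => t (k, i, j) := by
    ext N
    simp [Set.mem_pi, Prod.forall]
  rw [this, Measure.pi_pi]
  simp only [Measure.pi_pi, Fintype.prod_prod_type]

/-- The law of the noise. -/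
lemma IsGaussianNoise.hasLaw {N : Ω → Params L d} (h : IsGaussianNoise P N) :
    HasLaw (fun ω (k : Fin L) (i j : Fin d) => N ω k i j)
      (Measure.pi (fun _ : Fin L => gaussMat d)) P := by
  have hX : HasLaw (fun ω (q : Fin L × Fin d × Fin d) => N ω q.1 q.2.1 q.2.2)
      (Measure.pi (fun _ => gaussianReal 0 1)) P :=
    iIndepFun.hasLaw_pi (fun q : Fin L × Fin d × Fin d => h.1 q.1 q.2.1 q.2.2) h.2
  have hc : Measurable (fun (x : Fin L × Fin d × Fin d → ℝ) (k : Fin L) (i j : Fin d) =>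
      x (k, i, j)) := by fun_prop
  have hm : Measurable (fun (N : Fin L → Fin d → Fin d → ℝ) (q : Fin L × Fin d × Fin d) =>
      N q.1 q.2.1 q.2.2) := by fun_prop
  refine ⟨hc.comp_aemeasurable hX.aemeasurable, ?_⟩
  have h1 := AEMeasurable.map_map_of_aemeasurable hc.aemeasurable hX.aemeasurable
  have h2 : P.map (fun ω (k : Fin L) (i j : Fin d) => N ω k i j) = _ := h1.symm
  rw [h2, hX.map_eq, ← map_uncurry_pi_gaussMat, Measure.map_map hc hm]
  exact Measure.map_id

/-- A likely event for the law of a random variable pulls back to a likely measurable event. -/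
lemma exists_measurableSet_preimage [IsProbabilityMeasure P] {S : Type*} [MeasurableSpace S]
    {μ : Measure S} {X : Ω → S} (hX : HasLaw X μ P) {E : Set S} (hE : MeasurableSet E) {r : ℝ}
    (hr : 0 ≤ r) (hEr : μ Eᶜ ≤ ENNReal.ofReal r) :
    ∃ F : Set Ω, MeasurableSet F ∧ 1 - r ≤ P.real F ∧ ∀ ω ∈ F, X ω ∈ E := by
  -- `X` is only almost everywhere measurable, so the preimage of the bad set is enlarged to a
  -- measurable set of the same measure.
  refine ⟨(toMeasurable P (X ⁻¹' Eᶜ))ᶜ, (measurableSet_toMeasurable _ _).compl, ?_, ?_⟩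
  · rw [probReal_compl_eq_one_sub (measurableSet_toMeasurable _ _)]
    have : P.real (toMeasurable P (X ⁻¹' Eᶜ)) ≤ r := by
      rw [Measure.real, measure_toMeasurable, ← Measure.map_apply_of_aemeasurable hX.aemeasurable
        hE.compl, hX.map_eq]
      exact ENNReal.toReal_le_of_le_ofReal hr hEr
    linarith
  · intro ω hω
    by_contra hc
    exact hω (subset_toMeasurable _ _ hc)

end Law

/-! ### Assembly. -/

section Main

variable {L d : ℕ}

/-- Taking θ to be `L` times the displacement converts the radius 1/(2A²L) into a bound free of the
depth. -/
lemma IsComparable.exists_residual_minimizer {ρ : Matrix (Fin d) (Fin d) ℝ → ℝ}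
    {G : Matrix (Fin d) (Fin d) ℝ → Matrix (Fin d) (Fin d) ℝ} {m α β : ℝ}
    (h : IsComparable ρ G m α β) (hL : 0 < L) {s : ℝ} {N : Params L d} {A : ℝ} (hA : 0 < A)
    (h₀ : ∀ k ≤ L, TwoSided (prefixProd (residualInit s N) k) A)
    (hinit : ρ (netMatrix (residualInit s N)) - m ≤ (1 / (2048 * A ^ 11)) ^ 2 * α ^ 2 / β) :
    ∃ W' θ : Params L d,
      GradientFlowConvergesTo (fun W => ρ (netMatrix W)) (residualInit s N) W' ∧
      IsGlobalMinimizer (fun W : Params L d => ρ (netMatrix W)) W' ∧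
      W' = residualWeights s N θ ∧ ∀ k, frobNorm (θ k) ≤ 1 / (2 * A ^ 2) := by
  have hL' : (0 : ℝ) < L := by exact_mod_cast hL
  obtain ⟨W', hconv, hmin, hnear⟩ := h.gradientFlow_converges hL hA h₀ hinit
  refine ⟨W', fun k => (L : ℝ) • (W' k - residualInit s N k), hconv, fun V => ?_, ?_, fun k => ?_⟩
  · simp only [hmin]
    exact h.le _
  · funext k
    rw [residualWeights, smul_smul, one_div, inv_mul_cancel₀ hL'.ne', one_smul, residualInit]
    abel
  · rw [frobNorm_smul, abs_of_pos hL', mul_comm, ← le_div_iff₀ hL']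
    exact hnear k

lemma IsGaussianNoise.exists_event {Ω : Type*} [MeasurableSpace Ω] {P : Measure Ω}
    [IsProbabilityMeasure P] {N : Ω → Params L d} (hN : IsGaussianNoise P N) {s A : ℝ}
    (h : ∃ E : Set (Fin L → Fin d → Fin d → ℝ), MeasurableSet E ∧
      Measure.pi (fun _ : Fin L => gaussMat d) Eᶜ ≤ ENNReal.ofReal (3 * Real.exp (-d)) ∧
      ∀ N ∈ E, ∀ k ≤ L, TwoSided (prefixProd (layers (s / Real.sqrt ((L : ℝ) * d)) N) k) A) :
    ∃ E : Set Ω, MeasurableSet E ∧ 1 - 16 * Real.exp (-(1 * d)) ≤ P.real E ∧ ∀ ω ∈ E,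
      ∀ k ≤ L, TwoSided (prefixProd (residualInit s (N ω)) k) A := by
  obtain ⟨S, hS, hSp, hSt⟩ := h
  obtain ⟨E, hE, hEp, hEt⟩ := exists_measurableSet_preimage hN.hasLaw hS (by positivity) hSp
  refine ⟨E, hE, ?_, fun ω hω k hk => hSt _ (hEt ω hω) k hk⟩
  rw [one_mul]
  linarith [Real.exp_pos (-(d : ℝ))]

end Main

end DeepLinear

theorem theorem4 (s : ℝ) (hs : 0 ≤ s) :
    ∃ C₁ C₂ C₃ C₄ C₅ : ℝ, 0 < C₁ ∧ 0 < C₂ ∧ 0 < C₃ ∧ 0 < C₄ ∧ 0 < C₅ ∧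
      -- univariate regression, with the projection vector `p`
      (∀ (L d n : ℕ), C₁ ≤ (L : ℝ) → C₂ ≤ (d : ℝ) →
        ∀ (X : Matrix (Fin n) (Fin d) ℝ) (y : Fin n → ℝ) (p : Fin d → ℝ), X ≠ 0 →
        ∀ (Ω : Type*) [MeasurableSpace Ω] (P : Measure Ω) [IsProbabilityMeasure P]
          (N : Ω → DeepLinear.Params L d), DeepLinear.IsGaussianNoise P N →
        ∃ E : Set Ω, MeasurableSet E ∧ 1 - 16 * Real.exp (-(C₃ * d)) ≤ P.real E ∧
          ∀ ω ∈ E,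
            DeepLinear.netRisk X y p (DeepLinear.residualInit s (N ω)) - DeepLinear.minRisk X y ≤
              C₄ * DeepLinear.smallestNonzeroEig X ^ 2 * ‖WithLp.toLp 2 p‖ ^ 2 /
                DeepLinear.largestEig X →
            ∃ W' θ : DeepLinear.Params L d,
              DeepLinear.GradientFlowConvergesTo (DeepLinear.netRisk X y p)
                (DeepLinear.residualInit s (N ω)) W' ∧
              DeepLinear.IsGlobalMinimizer (DeepLinear.netRisk X y p) W' ∧
              W' = DeepLinear.residualWeights s (N ω) θ ∧
              ∀ k, DeepLinear.frobNorm (θ k) ≤ C₅) ∧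
      -- multivariate regression, without `p`
      (∀ (L d n : ℕ), C₁ ≤ (L : ℝ) → C₂ ≤ (d : ℝ) →
        ∀ (X Y : Matrix (Fin n) (Fin d) ℝ), X ≠ 0 →
        ∀ (Ω : Type*) [MeasurableSpace Ω] (P : Measure Ω) [IsProbabilityMeasure P]
          (N : Ω → DeepLinear.Params L d), DeepLinear.IsGaussianNoise P N →
        ∃ E : Set Ω, MeasurableSet E ∧ 1 - 16 * Real.exp (-(C₃ * d)) ≤ P.real E ∧
          ∀ ω ∈ E,
            DeepLinear.netRiskMulti X Y (DeepLinear.residualInit s (N ω)) -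
                DeepLinear.minRiskMulti X Y ≤
              C₄ * DeepLinear.smallestNonzeroEig X ^ 2 / DeepLinear.largestEig X →
            ∃ W' θ : DeepLinear.Params L d,
              DeepLinear.GradientFlowConvergesTo (DeepLinear.netRiskMulti X Y)
                (DeepLinear.residualInit s (N ω)) W' ∧
              DeepLinear.IsGlobalMinimizer (DeepLinear.netRiskMulti X Y) W' ∧
              W' = DeepLinear.residualWeights s (N ω) θ ∧
              ∀ k, DeepLinear.frobNorm (θ k) ≤ C₅) := by
  obtain ⟨A, C, hA, hC, hev⟩ := DeepLinear.exists_wellConditioned_event s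
  refine ⟨max C 1, 1, 1, (1 / (2048 * A ^ 11)) ^ 2, 1 / (2 * A ^ 2), by positivity, one_pos,
    one_pos, by positivity, by positivity, ?_, ?_⟩
  · intro L d n hL hd X y p hX Ω _ P _ N hN
    have hL0 : 0 < L := by exact_mod_cast one_pos.trans_le ((le_max_right C 1).trans hL)
    obtain ⟨E, hE, hEp, hEt⟩ := hN.exists_event
      (hev L d ((le_max_left _ _).trans hL) (by exact_mod_cast hd))
    refine ⟨E, hE, hEp, fun ω hω hinit => ?_⟩
    -- For p = 0 the comparison constants λ‖p‖² and Λ‖p‖² would vanish, so the constant risk is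
    -- treated separately. Otherwise α²/β = λ²‖p‖²/Λ is exactly the stated threshold.
    by_cases hp : p = 0
    · subst hp
      have hconst : DeepLinear.netRisk (L := L) X y (0 : Fin d → ℝ) =
          fun _ => DeepLinear.linRisk X y 0 := by
        funext W
        rw [DeepLinear.netRisk, mulVec_zero]
      rw [hconst]
      exact (DeepLinear.isComparable_const (DeepLinear.linRisk X y 0)).exists_residual_minimizer
        hL0 hA (hEt ω hω) (by rw [sub_self]; positivity)
    · have hpp := DeepLinear.vnorm_pos hp
      obtain ⟨hl, hu⟩ := DeepLinear.smallestNonzeroEig_pos hX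
      refine (DeepLinear.isComparable_linRisk y hX hp).exists_residual_minimizer
        hL0 hA (hEt ω hω) (hinit.trans (le_of_eq ?_))
      change _ * _ * DeepLinear.vnorm p ^ 2 / _ = _
      field_simp
  · intro L d n hL hd X Y hX Ω _ P _ N hN
    have hL0 : 0 < L := by exact_mod_cast one_pos.trans_le ((le_max_right C 1).trans hL)
    obtain ⟨E, hE, hEp, hEt⟩ := hN.exists_event
      (hev L d ((le_max_left _ _).trans hL) (by exact_mod_cast hd))
    exact ⟨E, hE, hEp, fun ω hω hinit =>
      (DeepLinear.isComparable_linRiskMulti Y hX).exists_residual_minimizer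
        hL0 hA (hEt ω hω) hinit⟩
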